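/- Let $m,n,k$ be integers with $1 \le k < \min\{m,n\}$, and identify $M_m\otimes M_n$ (complex matrices) with the linear operators on $\mathbb C^m\otimes\mathbb C^n$. The Schmidt rank $SR(v)$ of $v\in\mathbb C^m\otimes\mathbb C^n$ is the least integer $r$ such that $v$ is a linear combination of $r$ vectors of the form $a\otimes b$ with $a\in\mathbb C^m$, $b\in\mathbb C^n$ unit vectors. For $X\in M_m\otimes M_n$ put $$\|X\|_{S(k)}=\sup\{|v^\dagger Xw|:\ \|v\|=\|w\|=1,\ SR(v),SR(w)\le k\},$$ $$\|X\|_{\gamma,k}=\inf\Big\{\sum_i|c_i|:\ X=\sum_i c_i\,v_iw_i^\dagger\Big\},$$ where the infimum is over all finite decompositions with $c_i\in\mathbb C$ and unit vectors $v_i,w_i\in\mathbb C^m\otimes\mathbb C^n$ satisfying $SR(v_i),SR(w_i)\le k$. Let $\mathcal U$ be the set of matrices $U\in M_m\otimes M_n$ such that $U=U_1\otimes U_2$, or $n=m$ and $U=S(U_1\otimes U_2)$, where $U_1\in M_m$ and $U_2\in M_n$ are unitary and $S$ is the swap operator $S(a\otimes b)=b\otimes a$. Let $\Phi:M_m\otimes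 M_n\to M_m\otimes M_n$ be a (complex-)linear map. Then the following are equivalent: (a) $\|\Phi(X)\|_{S(k)}=\|X\|_{S(k)}$ for all $X\in M_m\otimes M_n$; (b) $\|\Phi(X)\|_{\gamma,k}=\|X\|_{\gamma,k}$ for all $X\in M_m\otimes M_n$; (c) $\Phi$ is a composition of one or more maps, each of which is of one of the following kinds: $X\mapsto UXV$ with $U,V\in\mathcal U$; the transpose map $X\mapsto X^T$ (with respect to the standard product basis); and, if $k=1$, the partial transpose $\mathrm{id}_m\otimes T$, where $T$ is the transpose map on $M_n$. -/

import Mathlib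

open scoped Matrix Kronecker

noncomputable section

namespace EntNorm

/-- `ℂ^m ⊗ ℂ^n` with its Hilbert space norm, in the product basis `e_i ⊗ e_j`. -/
abbrev Vec (m n : ℕ) : Type := EuclideanSpace ℂ (Fin m × Fin n)

/-- `M_m ⊗ M_n`, in the product basis; `A ⊗ B` is the Kronecker product `A ⊗ₖ B`. -/
abbrev Op (m n : ℕ) : Type := Matrix (Fin m × Fin n) (Fin m × Fin n) ℂ

/-- The elementary tensor `a ⊗ b`. -/
def tensorVec {m n : ℕ} (a : EuclideanSpace ℂ (Fin m)) (b : EuclideanSpace ℂ (Fin n)) :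
    Vec m n :=
  WithLp.toLp 2 fun p => a p.1 * b p.2

/-- A separable pure state: an elementary tensor of two unit vectors. -/
def IsSeparable {m n : ℕ} (v : Vec m n) : Prop :=
  ∃ (a : EuclideanSpace ℂ (Fin m)) (b : EuclideanSpace ℂ (Fin n)),
    ‖a‖ = 1 ∧ ‖b‖ = 1 ∧ v = tensorVec a b

/-- The Schmidt rank: the least number of separable pure states of which `v` is a linear
combination. -/
def schmidtRank {m n : ℕ} (v : Vec m n) : ℕ :=
  sInf {r : ℕ | ∃ (c : Fin r → ℂ) (u : Fin r → Vec m n),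
    (∀ i, IsSeparable (u i)) ∧ v = ∑ i, c i • u i}

/-- Unit vectors of Schmidt rank at most `k`. -/
def IsPureState {m n : ℕ} (k : ℕ) (v : Vec m n) : Prop :=
  ‖v‖ = 1 ∧ schmidtRank v ≤ k

/-- The `S(k)`-norm: the supremum of `|⟨v|X|w⟩|` over unit vectors of Schmidt rank at most `k`. -/
def skNorm {m n : ℕ} (k : ℕ) (X : Op m n) : ℝ :=
  sSup {r : ℝ | ∃ v w : Vec m n, IsPureState k v ∧ IsPureState k w ∧
    r = ‖star v.ofLp ⬝ᵥ (X *ᵥ w.ofLp)‖}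

/-- The norm `‖·‖_{γ,k}`: the infimum of `∑ |c_i|` over the finite decompositions
`X = ∑ c_i |v_i⟩⟨w_i|` with unit vectors `v_i`, `w_i` of Schmidt rank at most `k`. -/
def gammaNorm {m n : ℕ} (k : ℕ) (X : Op m n) : ℝ :=
  sInf {r : ℝ | ∃ (N : ℕ) (c : Fin N → ℂ) (v w : Fin N → Vec m n),
    (∀ i, IsPureState k (v i)) ∧ (∀ i, IsPureState k (w i)) ∧
    X = ∑ i, c i • Matrix.vecMulVec (v i).ofLp (star (w i).ofLp) ∧
    r = ∑ i, ‖c i‖}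

/-- The swap operator, `S (a ⊗ b) = b ⊗ a`, when the two factors have the same dimension. -/
def swapOp {m n : ℕ} (h : n = m) : Op m n :=
  Matrix.of fun p q => if p = (Fin.cast h q.2, Fin.cast h.symm q.1) then 1 else 0

/-- Matrices of the form `U₁ ⊗ U₂`, or (if `n = m`) `S (U₁ ⊗ U₂)`, with `U₁`, `U₂` unitary. -/
def IsLocalUnitary {m n : ℕ} (U : Op m n) : Prop :=
  ∃ U₁ ∈ Matrix.unitaryGroup (Fin m) ℂ, ∃ U₂ ∈ Matrix.unitaryGroup (Fin n) ℂ,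
    U = U₁ ⊗ₖ U₂ ∨ ∃ h : n = m, U = swapOp h * (U₁ ⊗ₖ U₂)

/-- The partial transpose `id_m ⊗ T`. -/
def partialTranspose {m n : ℕ} (X : Op m n) : Op m n :=
  Matrix.of fun p q => X (p.1, q.2) (q.1, p.2)

/-- The three kinds of maps from which the isometries are composed. -/
def generators (m n k : ℕ) : Set (Module.End ℂ (Op m n)) :=
  {Φ | (∃ U V : Op m n, IsLocalUnitary U ∧ IsLocalUnitary V ∧ ∀ X, Φ X = U * X * V) ∨
    (∀ X, Φ X = Xᵀ) ∨
    (k = 1 ∧ ∀ X, Φ X = partialTranspose X)}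

end EntNorm

end

/-! Let K be the set `unitOps` of operators `v w^T` with unit vectors `v`, `w` of Schmidt rank at
most `k`; conjugation preserves norm and rank, so the star in the definitions is harmless. K is
compact, and the unit ball of `‖·‖_{γ,k}` is its convex hull (`gammaNorm_le_one_iff`). K lies on the
Frobenius unit sphere, so by strict convexity K is exactly the set of extreme points of the hull,
and a γ-isometry permutes K. The `S(k)`-norm is the support function of K, so by Hahn–Banach the
transpose of an `S(k)`-isometry preserves the hull (`pairingTranspose_mem_convexHull`). Since the
generators are closed under transposes and inverses, both norms reduce to one question: which linear
bijections preserve K in both directions (`mem_closure_of_unitOps`)?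

Such a map also preserves the cone of operators `v w^T` with factors of rank at most `k`. Inside
this cone the case of rank one is detected linearly: `Z` is a product operator iff `Y` and `Y + Z`
in the cone force `Y + 2Z` into the cone (`LowRankOp.add_two_smul`, `LowRankOp.one_of_forall`). This
uses `k < min m n`. So product operators `(a ⊗ b)(c ⊗ d)^T` go to product operators.

These are the elementary tensors with four factors. On projective points the map is a bijection of
products that changes at most one coordinate when one coordinate is changed; a combinatorial
argument (`exists_perm_of_adjacent`) shows that it permutes the factors, and it acts linearly on
each (`exists_actsFactorwise`).

Swaps and the transpose, composed on both sides, reduce the permutation to the identity or the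
partial transpose. The latter is excluded for `k ≥ 2` by an operator whose left factor has Schmidt
rank two. With the trivial permutation the map is `X ↦ (A ⊗ B) X (C ⊗ D)^T`, and Frobenius norms of
product operators make the four matrices unitary up to scalars of product one. -/

noncomputable section

namespace EntNorm

/-! ### Bijections of products that respect adjacency -/

section Hamming

variable {ι : Type*} [DecidableEq ι] {X Y : ι → Type*}

/-- Moving the `i`-th coordinate of `x` moves only the `j`-th coordinate of `φ x`. -/
def MovesOnly (φ : (∀ i, X i) → ∀ j, Y j) (x : ∀ i, X i) (i j : ι) : Prop :=
  ∀ a, ∀ l, l ≠ j → φ (Function.update x i a) l = φ x l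

variable {φ : (∀ i, X i) → ∀ j, Y j}

theorem exists_ne_of_update (hinj : Function.Injective φ) {x : ∀ i, X i} {i : ι} {a : X i}
    (ha : a ≠ x i) {j : ι} (hj : ∀ l, l ≠ j → φ (Function.update x i a) l = φ x l) :
    φ (Function.update x i a) j ≠ φ x j := by
  intro h
  have : Function.update x i a = x := hinj (funext fun l => by
    by_cases hl : l = j
    · subst hl; exact h
    · exact hj l hl)
  exact ha (by simpa using congrFun this i)

/-- Three distinct points that pairwise differ in a single coordinate all differ in the same one, so
a whole line is sent into a line. -/
theorem exists_movesOnly (hinj : Function.Injective φ)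
    (hadj : ∀ x i a, ∃ j, ∀ l, l ≠ j → φ (Function.update x i a) l = φ x l)
    (x : ∀ i, X i) (i : ι) : ∃ j, MovesOnly φ x i j := by
  by_cases h : ∃ a, a ≠ x i
  · obtain ⟨a, ha⟩ := h
    obtain ⟨j, hj⟩ := hadj x i a
    have hja := exists_ne_of_update hinj ha hj
    refine ⟨j, fun b => ?_⟩
    by_cases hb : b = x i
    · subst hb; simp
    by_cases hab : b = a
    · subst hab; exact hj
    obtain ⟨l, hl⟩ := hadj x i b
    have hlb := exists_ne_of_update hinj hb hl
    obtain ⟨r, hr⟩ := hadj (Function.update x i a) i b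
    rw [Function.update_idem] at hr
    by_cases hjl : l = j
    · subst hjl; exact hl
    exfalso
    have h1 : r = j := by
      by_contra hne
      exact hja ((hr j (Ne.symm hne)).symm.trans (hl j (Ne.symm hjl)))
    have h2 : r = l := by
      by_contra hne
      exact hlb ((hr l (Ne.symm hne)).trans (hj l hjl))
    exact hjl (h2.symm.trans h1)
  · push Not at h
    exact ⟨i, fun a l _ => by rw [h a]; simp⟩

/-- Consider the square obtained by moving coordinates `i` and `i'`. If its two `i`-edges had images
in different directions, following the other two edges would identify two opposite corners of the
image, against injectivity. -/
theorem MovesOnly.update_of_ne (hinj : Function.Injective φ)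
    (hadj : ∀ x i a, ∃ j, ∀ l, l ≠ j → φ (Function.update x i a) l = φ x l)
    {x : ∀ i, X i} {i j i' : ι} (h : MovesOnly φ x i j) (hi : i' ≠ i) (b : X i') :
    MovesOnly φ (Function.update x i' b) i j := by
  by_cases hb : b = x i'
  · subst hb; simpa using h
  obtain ⟨j', hj'⟩ := exists_movesOnly hinj hadj (Function.update x i' b) i
  by_cases hjj : j = j'
  · subst hjj; exact hj'
  intro a
  by_cases ha : a = x i
  · subst ha
    have : x i = Function.update x i' b i := by rw [Function.update_of_ne hi.symm]
    rw [this]; simp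
  exfalso
  have ha' : a ≠ Function.update x i' b i := by rwa [Function.update_of_ne hi.symm]
  have hq := exists_ne_of_update hinj ha (h a)
  have hq' := exists_ne_of_update hinj ha' (hj' a)
  obtain ⟨l, hl⟩ := hadj x i' b
  obtain ⟨l', hl'⟩ := hadj (Function.update x i a) i' b
  rw [Function.update_comm hi.symm] at hl'
  have hqa := h a
  have hqb := hj' a
  have d1 : φ (Function.update (Function.update x i' b) i a) ≠ φ x := fun e => by
    have := congrFun (hinj e) i
    simp at this; exact ha this
  have d2 : φ (Function.update x i' b) ≠ φ (Function.update x i a) := fun e => by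
    have := congrFun (hinj e) i
    rw [Function.update_of_ne hi.symm] at this
    simp at this; exact ha this.symm
  by_cases hlj : l = j
  · subst hlj
    have e1 : l' = j' := by
      by_contra hne
      apply hq'
      rw [hl' j' (Ne.symm hne), hqa j' (Ne.symm hjj), hl j' (Ne.symm hjj)]
    subst e1
    apply d2
    funext r
    by_cases hr : r = l
    · subst hr
      rw [← hqb r hjj, hl' r hjj]
    · rw [hl r hr, hqa r hr]
  · have e1 : l' = j := by
      by_contra hne
      apply hq
      rw [← hl' j (Ne.symm hne), hqb j hjj, hl j (Ne.symm hlj)]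
    subst e1
    apply d1
    funext r
    by_cases hr : r = l'
    · subst hr
      rw [hqb r hjj, hl r (Ne.symm hlj)]
    · rw [hl' r hr, hqa r hr]

theorem MovesOnly.congr_point [Fintype ι] (hinj : Function.Injective φ)
    (hadj : ∀ x i a, ∃ j, ∀ l, l ≠ j → φ (Function.update x i a) l = φ x l)
    {x : ∀ i, X i} {i j : ι} (h : MovesOnly φ x i j) (y : ∀ i, X i) : MovesOnly φ y i j := by
  have key : ∀ s : Finset ι, MovesOnly φ (s.piecewise y x) i j := by
    intro s
    induction s using Finset.induction_on with
    | empty => simpa using h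
    | insert r s _ ih =>
      rw [Finset.piecewise_insert]
      -- Moving coordinate `i` itself stays on the same line, so only the other coordinates need the
      -- square argument.
      by_cases hr : r = i
      · subst hr
        intro a l hl
        rw [Function.update_idem, ih a l hl, ih _ l hl]
      · exact ih.update_of_ne hinj hadj hr _
  simpa using key Finset.univ

/-- A bijection between products that moves one coordinate whenever one coordinate is moved is,
up to a permutation of the coordinates, a product of maps. -/
theorem exists_perm_of_adjacent [Fintype ι] [∀ i, Nonempty (X i)] [∀ i, Nontrivial (Y i)]
    (hinj : Function.Injective φ) (hsurj : Function.Surjective φ)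
    (hadj : ∀ x i a, ∃ j, ∀ l, l ≠ j → φ (Function.update x i a) l = φ x l) :
    ∃ ρ : Equiv.Perm ι, ∀ x y j, x (ρ j) = y (ρ j) → φ x j = φ y j := by
  let x₀ : ∀ i, X i := fun i => Classical.arbitrary _
  choose σ hσ using fun i => exists_movesOnly hinj hadj x₀ i
  have hσ' : ∀ i x, MovesOnly φ x i (σ i) := fun i x => (hσ i).congr_point hinj hadj x
  -- Output `j` sees only the inputs that `σ` sends to `j`. If there were none it would be constant,
  -- contradicting surjectivity; so `σ` is onto, hence a permutation.
  have dep : ∀ x y j, (∀ i, σ i = j → x i = y i) → φ x j = φ y j := by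
    intro x y j h
    have key : ∀ s : Finset ι, φ (s.piecewise y x) j = φ x j := by
      intro s
      induction s using Finset.induction_on with
      | empty => simp
      | insert r s hr ih =>
        rw [Finset.piecewise_insert]
        by_cases hrj : σ r = j
        · have : y r = s.piecewise y x r := by
            rw [Finset.piecewise_eq_of_notMem _ _ _ hr, h r hrj]
          rw [this, Function.update_eq_self, ih]
        · rw [hσ' r _ _ _ (Ne.symm hrj), ih]
    simpa using (key Finset.univ).symm
  have hs : Function.Surjective σ := by
    intro j
    by_contra hno
    push Not at hno
    obtain ⟨p, q, hpq⟩ := exists_pair_ne (Y j)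
    obtain ⟨x, hx⟩ := hsurj (Function.update (φ x₀) j p)
    obtain ⟨y, hy⟩ := hsurj (Function.update (φ x₀) j q)
    have := dep x y j fun i hi => absurd hi (hno i)
    rw [hx, hy] at this
    simp at this
    exact hpq this
  let e := Equiv.ofBijective σ (Finite.surjective_iff_bijective.1 hs)
  refine ⟨e.symm, fun x y j h => dep x y j fun i hi => ?_⟩
  have : e.symm j = i := by rw [← hi]; exact e.symm_apply_apply i
  rw [← this]; exact h

end Hamming

/-! ### Linear bijections that preserve elementary tensors -/

section ProductTensor

/-- If `p q^T + p' q'^T = v w^T` and `p`, `p'` are not proportional, then `q` and `q'` are multiples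
of `w`. -/
theorem exists_smul_of_add_eq_mul {α β : Type*} {p p' v : α → ℂ} {q q' w : β → ℂ} {s t : α}
    (hdet : p s * p' t - p t * p' s ≠ 0)
    (h : ∀ i j, p i * q j + p' i * q' j = v i * w j) :
    (∃ c : ℂ, q = c • w) ∧ ∃ c : ℂ, q' = c • w := by
  -- Cramer's rule for the two equations of rows `s` and `t`.
  refine ⟨⟨(v s * p' t - v t * p' s) / (p s * p' t - p t * p' s), ?_⟩,
    ⟨(p s * v t - p t * v s) / (p s * p' t - p t * p' s), ?_⟩⟩
  · funext j
    rw [Pi.smul_apply, smul_eq_mul, div_mul_eq_mul_div, eq_div_iff hdet]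
    linear_combination p' t * h s j - p' s * h t j
  · funext j
    rw [Pi.smul_apply, smul_eq_mul, div_mul_eq_mul_div, eq_div_iff hdet]
    linear_combination p s * h t j - p t * h s j

/-- Two nonzero functions whose `2 × 2` minors vanish are proportional. -/
theorem exists_smul_of_minors {α : Type*} {p q : α → ℂ} (hp : p ≠ 0)
    (h : ∀ s t, p s * q t - p t * q s = 0) : ∃ c : ℂ, q = c • p := by
  obtain ⟨s, hs⟩ := Function.ne_iff.1 hp
  simp only [Pi.zero_apply] at hs
  refine ⟨q s / p s, funext fun t => ?_⟩
  simp only [Pi.smul_apply, smul_eq_mul]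
  field_simp
  linear_combination h s t

variable {ι : Type*} {κ : ι → Type*}

theorem exists_prodTensor_ne {x : ∀ i, κ i → ℂ} (hx : ∀ i, x i ≠ 0) :
    ∃ J : ∀ i, κ i, ∀ i, x i (J i) ≠ 0 := by
  choose J hJ using fun i => Function.ne_iff.1 (hx i)
  exact ⟨J, hJ⟩

theorem update_ne_zero [DecidableEq ι] {x : ∀ i, κ i → ℂ} (hx : ∀ i, x i ≠ 0) {i : ι}
    {v : κ i → ℂ} (hv : v ≠ 0) (r : ι) : Function.update x i v r ≠ 0 := by
  by_cases hr : r = i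
  · subst hr; simpa using hv
  · rw [Function.update_of_ne hr]; exact hx r

variable [Fintype ι]

/-- The elementary tensor with the given factors. -/
def prodTensor (x : ∀ i, κ i → ℂ) : (∀ i, κ i) → ℂ := fun J => ∏ i, x i (J i)

theorem prodTensor_smul (c : ι → ℂ) (x : ∀ i, κ i → ℂ) :
    prodTensor (fun i => c i • x i) = (∏ i, c i) • prodTensor x := by
  funext J
  simp [prodTensor, Finset.prod_mul_distrib]

theorem prodTensor_ne_zero {x : ∀ i, κ i → ℂ} (hx : ∀ i, x i ≠ 0) : prodTensor x ≠ 0 := by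
  obtain ⟨J, hJ⟩ := exists_prodTensor_ne hx
  exact fun h => Finset.prod_ne_zero_iff.2 (fun i _ => hJ i) (congrFun h J)

theorem ne_zero_of_prodTensor {x : ∀ i, κ i → ℂ} (h : prodTensor x ≠ 0) (i : ι) : x i ≠ 0 := by
  intro hi
  apply h
  funext J
  exact Finset.prod_eq_zero (Finset.mem_univ i) (by simp [hi])

/-- `Φ` maps elementary tensors to elementary tensors, permuting the factors by `ρ` and acting
linearly and injectively on each of them. -/
def ActsFactorwise (Φ : ((∀ i, κ i) → ℂ) →ₗ[ℂ] ((∀ i, κ i) → ℂ)) (ρ : ι → ι) : Prop :=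
  ∃ A : ∀ j, (κ (ρ j) → ℂ) →ₗ[ℂ] (κ j → ℂ), (∀ j, Function.Injective (A j)) ∧
    ∀ x : ∀ i, κ i → ℂ, (∀ i, x i ≠ 0) →
      ∃ c : ℂ, c ≠ 0 ∧ Φ (prodTensor x) = c • prodTensor fun j => A j (x (ρ j))

/-- Output factor `j` is read from input factor `ρ j`, so the permutations compose in the reverse
order of the maps. -/
theorem ActsFactorwise.comp {Φ Ψ : ((∀ i, κ i) → ℂ) →ₗ[ℂ] ((∀ i, κ i) → ℂ)} {ρ τ : ι → ι}
    (hΦ : ActsFactorwise Φ ρ) (hΨ : ActsFactorwise Ψ τ) : ActsFactorwise (Ψ ∘ₗ Φ) (ρ ∘ τ) := by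
  obtain ⟨A, hA, hΦ⟩ := hΦ
  obtain ⟨B, hB, hΨ⟩ := hΨ
  refine ⟨fun j => B j ∘ₗ A (τ j), fun j => (hB j).comp (hA _), fun x hx => ?_⟩
  obtain ⟨c, hc, e⟩ := hΦ x hx
  obtain ⟨c', hc', e'⟩ := hΨ (fun j => A j (x (ρ j))) fun j h0 => hx (ρ j) (by
    exact (injective_iff_map_eq_zero (A j)).1 (hA j) _ h0)
  refine ⟨c * c', mul_ne_zero hc hc', ?_⟩
  rw [LinearMap.comp_apply, e, map_smul, e', smul_smul]
  rfl

variable [DecidableEq ι]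

theorem prodTensor_update_apply_update (x : ∀ i, κ i → ℂ) (J : ∀ i, κ i) (i : ι) (v : κ i → ℂ)
    (t : κ i) : prodTensor (Function.update x i v) (Function.update J i t) =
      v t * ∏ r ∈ Finset.univ.erase i, x r (J r) := by
  rw [prodTensor, ← Finset.mul_prod_erase _ _ (Finset.mem_univ i)]
  congr 1
  · simp
  · refine Finset.prod_congr rfl fun r hr => ?_
    have := Finset.ne_of_mem_erase hr
    simp [Function.update_of_ne this]

theorem prodTensor_apply_update (x : ∀ i, κ i → ℂ) (J : ∀ i, κ i) (i : ι) (t : κ i) :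
    prodTensor x (Function.update J i t) = x i t * ∏ r ∈ Finset.univ.erase i, x r (J r) := by
  simpa using prodTensor_update_apply_update x J i (x i) t

theorem prodTensor_update_apply (x : ∀ i, κ i → ℂ) (J : ∀ i, κ i) (i : ι) (v : κ i → ℂ) :
    prodTensor (Function.update x i v) J = v (J i) * ∏ r ∈ Finset.univ.erase i, x r (J r) := by
  simpa using prodTensor_update_apply_update x J i v (J i)

/-- The elementary tensor as a linear function of one of its factors. -/
def prodTensorLine (x : ∀ i, κ i → ℂ) (i : ι) : (κ i → ℂ) →ₗ[ℂ] ((∀ i, κ i) → ℂ) where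
  toFun v := prodTensor (Function.update x i v)
  map_add' v w := by
    funext J; simp only [prodTensor_update_apply, Pi.add_apply]; ring
  map_smul' c v := by
    funext J; simp only [prodTensor_update_apply, Pi.smul_apply, smul_eq_mul, RingHom.id_apply]
    ring

@[simp] theorem prodTensorLine_apply (x : ∀ i, κ i → ℂ) (i : ι) (v : κ i → ℂ) :
    prodTensorLine x i v = prodTensor (Function.update x i v) := rfl

/-- The factors of a nonzero elementary tensor are unique up to scalars. -/
theorem exists_smul_of_prodTensor_eq {x y : ∀ i, κ i → ℂ} {c : ℂ} (hx : ∀ i, x i ≠ 0)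
    (h : prodTensor x = c • prodTensor y) (i : ι) : ∃ a : ℂ, x i = a • y i := by
  obtain ⟨J, hJ⟩ := exists_prodTensor_ne hx
  have hP : ∏ r ∈ Finset.univ.erase i, x r (J r) ≠ 0 := Finset.prod_ne_zero_iff.2 fun r _ => hJ r
  refine ⟨c * (∏ r ∈ Finset.univ.erase i, y r (J r)) / ∏ r ∈ Finset.univ.erase i, x r (J r),
    funext fun t => ?_⟩
  have := congrFun h (Function.update J i t)
  simp only [Pi.smul_apply, smul_eq_mul, prodTensor_apply_update] at this ⊢
  field_simp
  linear_combination this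

/-- If the sum of two elementary tensors is elementary, then they have proportional factors in all
positions but at most one. -/
theorem exists_smul_of_add_eq_prodTensor {f g h : ∀ i, κ i → ℂ} (hf : ∀ i, f i ≠ 0)
    (hg : ∀ i, g i ≠ 0) (hsum : prodTensor f + prodTensor g = prodTensor h) {i : ι}
    (hi : ¬ ∃ a : ℂ, g i = a • f i) {l : ι} (hl : l ≠ i) : ∃ a : ℂ, f l = a • g l := by
  have hdet : ∃ s t, f i s * g i t - f i t * g i s ≠ 0 := by
    by_contra hno
    push Not at hno
    exact hi (exists_smul_of_minors (hf i) hno)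
  obtain ⟨s, t, hdet⟩ := hdet
  -- Flattening splits off factor `i`. Putting the all-ones vector in its place keeps the remaining
  -- factors as a tensor over the same index family.
  let one : κ i → ℂ := fun _ => 1
  have hone : one ≠ 0 := Function.ne_iff.2 ⟨s, by simp [one]⟩
  have upd : ∀ {z : ∀ i, κ i → ℂ}, (∀ i, z i ≠ 0) → ∀ r, Function.update z i one r ≠ 0 := by
    intro z hz r
    by_cases hr : r = i
    · subst hr; simpa using hone
    · rw [Function.update_of_ne hr]; exact hz r
  have H := exists_smul_of_add_eq_mul (q := prodTensor (Function.update f i one))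
    (q' := prodTensor (Function.update g i one)) (w := prodTensor (Function.update h i one))
    (v := h i) hdet (by
      intro r J
      have := congrFun hsum (Function.update J i r)
      simp only [Pi.add_apply, prodTensor_apply_update] at this
      simp only [prodTensor_update_apply, one, one_mul]
      exact this)
  obtain ⟨⟨c, hc⟩, c', hc'⟩ := H
  have hc0 : c' ≠ 0 := fun h0 => prodTensor_ne_zero (upd hg) (by rw [hc', h0, zero_smul])
  have e : prodTensor (Function.update f i one) =
      (c * c'⁻¹) • prodTensor (Function.update g i one) := by
    rw [hc', smul_smul, mul_assoc, inv_mul_cancel₀ hc0, mul_one, hc]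
  have := exists_smul_of_prodTensor_eq (upd hf) e l
  simpa [Function.update_of_ne hl] using this

open Projectivization LinearAlgebra.Projectivization in
/-- A map of projective points induced by a linear bijection that preserves elementary tensors. -/
theorem exists_projective_map (Φ : ((∀ i, κ i) → ℂ) ≃ₗ[ℂ] ((∀ i, κ i) → ℂ))
    (h : ∀ x : ∀ i, κ i → ℂ, ∃ y : ∀ i, κ i → ℂ, Φ (prodTensor x) = prodTensor y) :
    ∃ φ : (∀ i, ℙ ℂ (κ i → ℂ)) → ∀ i, ℙ ℂ (κ i → ℂ),
      ∀ (x y : ∀ i, κ i → ℂ) (hx : ∀ i, x i ≠ 0) (hy : ∀ i, y i ≠ 0) (c : ℂ),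
        Φ (prodTensor x) = c • prodTensor y →
          φ (fun i => mk ℂ (x i) (hx i)) = fun i => mk ℂ (y i) (hy i) := by
  choose F hF using h
  have hF0 : ∀ x : ∀ i, κ i → ℂ, (∀ i, x i ≠ 0) → ∀ i, F x i ≠ 0 := fun x hx i =>
    ne_zero_of_prodTensor (by
      rw [← hF]; exact fun h0 => prodTensor_ne_zero hx (by simpa using h0)) i
  refine ⟨fun p i => mk ℂ (F (fun r => (p r).rep) i) (hF0 _ (fun r => rep_nonzero _) i), ?_⟩
  intro x y hx hy c hxy
  choose a ha using fun i => exists_smul_eq_mk_rep ℂ (x i) (hx i)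
  funext i
  have hne := hF0 (fun r => (mk ℂ (x r) (hx r)).rep) (fun r => rep_nonzero _)
  have e : prodTensor (F fun r => (mk ℂ (x r) (hx r)).rep) =
      ((∏ r, (a r : ℂ)) * c) • prodTensor y := by
    rw [← hF, mul_smul, ← hxy, ← map_smul, ← prodTensor_smul]
    congr 2
    funext r
    rw [← ha r]; rfl
  obtain ⟨b, hb⟩ := exists_smul_of_prodTensor_eq hne e i
  exact (mk_eq_mk_iff' ℂ _ _ _ _).2 ⟨b, hb.symm⟩

-- The projective maps induced by `Φ` and `Φ.symm` are mutually inverse. Adjacency holds because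
-- elementary tensors with factors `x i`, `v` and `x i + v` in one place form a sum whose image is
-- again elementary, so at most one factor changes its class.
open Projectivization LinearAlgebra.Projectivization in
theorem exists_perm_projective (Φ : ((∀ i, κ i) → ℂ) ≃ₗ[ℂ] ((∀ i, κ i) → ℂ))
    [∀ i, Nontrivial (κ i)]
    (h : ∀ x : ∀ i, κ i → ℂ, ∃ y : ∀ i, κ i → ℂ, Φ (prodTensor x) = prodTensor y)
    (h' : ∀ x : ∀ i, κ i → ℂ, ∃ y : ∀ i, κ i → ℂ, Φ.symm (prodTensor x) = prodTensor y) :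
    ∃ ρ : Equiv.Perm ι, ∀ x x' y y' : ∀ i, κ i → ℂ, (∀ i, x i ≠ 0) → (∀ i, x' i ≠ 0) →
      Φ (prodTensor x) = prodTensor y → Φ (prodTensor x') = prodTensor y' →
      ∀ j, x (ρ j) = x' (ρ j) → ∃ a : ℂ, y j = a • y' j := by
  classical
  obtain ⟨φ, hφ⟩ := exists_projective_map Φ h
  obtain ⟨ψ, hψ⟩ := exists_projective_map Φ.symm h'
  have ne : ∀ {x y : ∀ i, κ i → ℂ}, (∀ i, x i ≠ 0) → Φ (prodTensor x) = prodTensor y →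
      ∀ i, y i ≠ 0 := fun hx hxy i => ne_zero_of_prodTensor (by
        rw [← hxy]; exact fun h0 => prodTensor_ne_zero hx (by simpa using h0)) i
  have ne' : ∀ {x y : ∀ i, κ i → ℂ}, (∀ i, x i ≠ 0) → Φ.symm (prodTensor x) = prodTensor y →
      ∀ i, y i ≠ 0 := fun hx hxy i => ne_zero_of_prodTensor (by
        rw [← hxy]; exact fun h0 => prodTensor_ne_zero hx (by simpa using h0)) i
  have exrep : ∀ p : ∀ i, ℙ ℂ (κ i → ℂ), ∃ (x : ∀ i, κ i → ℂ) (hx : ∀ i, x i ≠ 0),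
      p = fun i => mk ℂ (x i) (hx i) := fun p =>
    ⟨fun i => (p i).rep, fun i => rep_nonzero _, funext fun i => (mk_rep _).symm⟩
  have hleft : Function.LeftInverse ψ φ := by
    intro p
    obtain ⟨x, hx, rfl⟩ := exrep p
    obtain ⟨y, hy⟩ := h x
    rw [hφ x y hx (ne hx hy) 1 (by rw [hy, one_smul])]
    exact hψ _ _ _ _ 1 (by rw [← hy]; simp)
  have hright : Function.RightInverse ψ φ := by
    intro p
    obtain ⟨x, hx, rfl⟩ := exrep p
    obtain ⟨y, hy⟩ := h' x
    rw [hψ x y hx (ne' hx hy) 1 (by rw [hy, one_smul])]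
    exact hφ _ _ _ _ 1 (by rw [← hy]; simp)
  have hnt : ∀ i, Nontrivial (ℙ ℂ (κ i → ℂ)) := by
    intro i
    obtain ⟨s, t, hst⟩ := exists_pair_ne (κ i)
    refine ⟨mk ℂ (Pi.single s 1) (by simp), mk ℂ (Pi.single t 1) (by simp), fun e => ?_⟩
    obtain ⟨a, ha⟩ := (mk_eq_mk_iff' ℂ _ _ _ _).1 e
    have := congrFun ha s
    simp [hst] at this
  have hadj : ∀ x i a, ∃ j, ∀ l, l ≠ j → φ (Function.update x i a) l = φ x l := by
    intro p i q
    obtain ⟨x, hx, rfl⟩ := exrep p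
    obtain ⟨v, hv, rfl⟩ : ∃ (v : κ i → ℂ) (hv : v ≠ 0), q = mk ℂ v hv :=
      ⟨q.rep, rep_nonzero _, (mk_rep _).symm⟩
    have e : Function.update (fun i => mk ℂ (x i) (hx i)) i (mk ℂ v hv) =
        fun r => mk ℂ (Function.update x i v r) (update_ne_zero hx hv r) := by
      funext r
      by_cases hr : r = i
      · subst hr; simp
      · simp [Function.update_of_ne hr]
    obtain ⟨y, hy⟩ := h x
    obtain ⟨z, hz⟩ := h (Function.update x i v)
    obtain ⟨w, hw⟩ := h (Function.update x i (x i + v))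
    have hy0 := ne hx hy
    have hz0 := ne (update_ne_zero hx hv) hz
    rw [e, hφ x y hx hy0 1 (by rw [hy, one_smul]),
      hφ _ z (update_ne_zero hx hv) hz0 1 (by rw [hz, one_smul])]
    have hsum : prodTensor z + prodTensor y = prodTensor w := by
      rw [← hy, ← hz, ← hw, ← map_add]
      congr 1
      have := (prodTensorLine x i).map_add (x i) v
      simp only [prodTensorLine_apply, Function.update_eq_self] at this
      rw [this, add_comm]
    by_cases hno : ∃ j, ¬ ∃ a : ℂ, y j = a • z j
    · obtain ⟨j, hj⟩ := hno
      refine ⟨j, fun l hl => ?_⟩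
      obtain ⟨a, ha⟩ := exists_smul_of_add_eq_prodTensor hz0 hy0 hsum hj hl
      exact (mk_eq_mk_iff' ℂ _ _ _ _).2 ⟨a, ha.symm⟩
    · push Not at hno
      refine ⟨i, fun l _ => ?_⟩
      obtain ⟨a, ha⟩ := hno l
      exact ((mk_eq_mk_iff' ℂ _ _ _ _).2 ⟨a, ha.symm⟩).symm
  obtain ⟨ρ, hρ⟩ := exists_perm_of_adjacent hleft.injective hright.surjective hadj
  refine ⟨ρ, fun x x' y y' hx hx' hy hy' j hj => ?_⟩
  have := hρ (fun i => mk ℂ (x i) (hx i)) (fun i => mk ℂ (x' i) (hx' i)) j (by simp [hj])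
  rw [hφ x y hx (ne hx hy) 1 (by rw [hy, one_smul]),
    hφ x' y' hx' (ne hx' hy') 1 (by rw [hy', one_smul])] at this
  obtain ⟨a, ha⟩ := (mk_eq_mk_iff' ℂ _ _ _ _).1 this
  exact ⟨a, ha.symm⟩

/-- A linear bijection that preserves elementary tensors, together with its inverse, acts
factorwise. -/
theorem exists_actsFactorwise (Φ : ((∀ i, κ i) → ℂ) ≃ₗ[ℂ] ((∀ i, κ i) → ℂ))
    [∀ i, Nontrivial (κ i)]
    (h : ∀ x : ∀ i, κ i → ℂ, ∃ y : ∀ i, κ i → ℂ, Φ (prodTensor x) = prodTensor y)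
    (h' : ∀ x : ∀ i, κ i → ℂ, ∃ y : ∀ i, κ i → ℂ, Φ.symm (prodTensor x) = prodTensor y) :
    ∃ ρ : Equiv.Perm ι, ActsFactorwise (Φ : ((∀ i, κ i) → ℂ) →ₗ[ℂ] ((∀ i, κ i) → ℂ)) ρ := by
  obtain ⟨ρ, hρ⟩ := exists_perm_projective Φ h h'
  choose F hF using h
  have hF0 : ∀ x : ∀ i, κ i → ℂ, (∀ i, x i ≠ 0) → ∀ i, F x i ≠ 0 := fun x hx i =>
    ne_zero_of_prodTensor (by
      rw [← hF]; exact fun h0 => prodTensor_ne_zero hx (by simpa using h0)) i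
  let x₀ : ∀ i, κ i → ℂ := fun i _ => 1
  have hx₀ : ∀ i, x₀ i ≠ 0 := fun i =>
    Function.ne_iff.2 ⟨Classical.arbitrary _, by simp [x₀]⟩
  obtain ⟨J, hJ⟩ := exists_prodTensor_ne (hF0 x₀ hx₀)
  -- Vary factor `ρ j` of a base tensor and read the image along the line in direction `j` through
  -- `J`, a multi-index at which the image of the base tensor has nonzero factors. This is linear by
  -- construction, although `F` itself is only a choice.
  let A : ∀ j, (κ (ρ j) → ℂ) →ₗ[ℂ] (κ j → ℂ) := fun j =>
    (LinearMap.pi fun t => LinearMap.proj (Function.update J j t)) ∘ₗ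
      (Φ : ((∀ i, κ i) → ℂ) →ₗ[ℂ] ((∀ i, κ i) → ℂ)) ∘ₗ prodTensorLine x₀ (ρ j)
  have hA : ∀ j v, v ≠ 0 → ∃ a : ℂ, a ≠ 0 ∧
      A j v = a • F (Function.update x₀ (ρ j) v) j := by
    intro j v hv
    refine ⟨∏ r ∈ Finset.univ.erase j, F (Function.update x₀ (ρ j) v) r (J r),
      Finset.prod_ne_zero_iff.2 fun r hr => ?_, ?_⟩
    · have hrj := Finset.ne_of_mem_erase hr
      -- For `r ≠ j` the factor stays proportional to that of the base image, so it still does not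
      -- vanish at `J r`.
      obtain ⟨a, ha⟩ := hρ _ _ _ _ hx₀ (update_ne_zero hx₀ hv) (hF _)
        (hF (Function.update x₀ (ρ j) v)) r (by
          rw [Function.update_of_ne (ρ.injective.ne hrj)])
      intro h0
      exact hJ r (by rw [ha, Pi.smul_apply, h0, smul_zero])
    · funext t
      simp only [A, LinearMap.comp_apply, LinearMap.pi_apply, prodTensorLine_apply,
        LinearEquiv.coe_coe, LinearMap.proj_apply, hF, prodTensor_apply_update, Pi.smul_apply,
        smul_eq_mul]
      ring
  have hA0 : ∀ j v, v ≠ 0 → A j v ≠ 0 := by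
    intro j v hv
    obtain ⟨a, ha, e⟩ := hA j v hv
    rw [e]
    exact smul_ne_zero ha (hF0 _ (update_ne_zero hx₀ hv) j)
  refine ⟨ρ, A, fun j => (injective_iff_map_eq_zero (A j)).2 fun v hv => ?_, fun x hx => ?_⟩
  · by_contra h0
    exact hA0 j v h0 hv
  · have : ∀ j, ∃ b : ℂ, F x j = b • A j (x (ρ j)) := by
      intro j
      obtain ⟨a, ha, e⟩ := hA j _ (hx (ρ j))
      obtain ⟨b, hb⟩ := hρ _ _ _ _ hx (update_ne_zero hx₀ (hx (ρ j))) (hF x) (hF _) j (by simp)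
      refine ⟨b * a⁻¹, ?_⟩
      rw [e, smul_smul, mul_assoc, inv_mul_cancel₀ ha, mul_one, hb]
    choose b hb using this
    refine ⟨∏ j, b j, Finset.prod_ne_zero_iff.2 fun j _ h0 => hF0 x hx j ?_, ?_⟩
    · rw [hb, h0, zero_smul]
    · rw [← prodTensor_smul, LinearEquiv.coe_coe, hF]
      congr 1
      funext j
      exact hb j

/-- A linear map that maps every elementary tensor to a multiple of itself is a scalar. -/
theorem exists_eq_smul_of_prodTensor [∀ i, Fintype (κ i)] [∀ i, DecidableEq (κ i)]
    [∀ i, Nonempty (κ i)] (Φ : ((∀ i, κ i) → ℂ) →ₗ[ℂ] ((∀ i, κ i) → ℂ))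
    (h : ∀ x : ∀ i, κ i → ℂ, (∀ i, x i ≠ 0) → ∃ c : ℂ, Φ (prodTensor x) = c • prodTensor x) :
    ∃ c : ℂ, ∀ X, Φ X = c • X := by
  have hs : ∀ J : ∀ i, κ i,
      (Pi.single J 1 : (∀ i, κ i) → ℂ) = prodTensor fun i => Pi.single (J i) 1 := by
    intro J
    funext K
    by_cases hK : K = J
    · subst hK; simp [prodTensor]
    · obtain ⟨i, hi⟩ := Function.ne_iff.1 hK
      rw [Pi.single_eq_of_ne hK, prodTensor,
        Finset.prod_eq_zero (Finset.mem_univ i) (by simp [hi])]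
  choose c hc using fun J : ∀ i, κ i => h (fun i => Pi.single (J i) 1) fun i => by simp
  obtain ⟨a, ha⟩ := h (fun i _ => 1) fun i =>
    Function.ne_iff.2 ⟨Classical.arbitrary _, by simp⟩
  have hone : (prodTensor fun (i : ι) (_ : κ i) => (1 : ℂ)) = ∑ J : ∀ i, κ i, Pi.single J 1 := by
    funext K
    simp [prodTensor, Finset.sum_apply, Pi.single_apply]
  -- The all-ones elementary tensor is the sum of all basis tensors, which forces their scalars to
  -- agree.
  have hca : ∀ J, c J = a := by
    intro J
    have := congrFun ha J
    rw [hone, map_sum] at this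
    simp only [hs, hc] at this
    simp only [← hs] at this
    simpa [Finset.sum_apply, Pi.single_apply] using this
  refine ⟨a, fun X => ?_⟩
  have : Φ = a • LinearMap.id := by
    refine LinearMap.pi_ext' fun J => LinearMap.ext_ring ?_
    simp only [LinearMap.comp_apply, LinearMap.coe_single, LinearMap.smul_apply,
      LinearMap.id_apply]
    rw [hs, hc, hca]
  rw [this]; rfl

end ProductTensor

/-! ### Rank along a line of linear maps -/

section Rank

open Module

variable {V W : Type*} [AddCommGroup V] [Module ℂ V] [AddCommGroup W] [Module ℂ W]

theorem finrank_range_add_le [FiniteDimensional ℂ V] (f g : V →ₗ[ℂ] W) :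
    finrank ℂ (f + g).range ≤ finrank ℂ f.range + finrank ℂ g.range := by
  have h : (f + g).range ≤ f.range ⊔ g.range := by
    rintro _ ⟨x, rfl⟩
    exact Submodule.add_mem_sup ⟨x, rfl⟩ ⟨x, rfl⟩
  exact (Submodule.finrank_mono h).trans (Submodule.finrank_add_le_finrank_add_finrank _ _)

theorem finrank_range_smulRight_le (b : V →ₗ[ℂ] ℂ) (a : W) :
    finrank ℂ (b.smulRight a).range ≤ 1 := by
  have : (b.smulRight a).range ≤ Submodule.span ℂ {a} := by
    rintro _ ⟨x, rfl⟩
    exact Submodule.smul_mem _ _ (Submodule.mem_span_singleton_self _)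
  refine (Submodule.finrank_mono this).trans ?_
  simpa using finrank_span_le_card (R := ℂ) ({a} : Set W)

variable [FiniteDimensional ℂ V]

/-- Along a line of direction of rank one, two points of rank at most `k` force a third one. -/
theorem finrank_range_add_two_smul_le {k : ℕ} (f : V →ₗ[ℂ] W) (b : V →ₗ[ℂ] ℂ) (a : W)
    (hf : finrank ℂ f.range ≤ k) (hfz : finrank ℂ (f + b.smulRight a).range ≤ k) :
    finrank ℂ (f + (2 : ℂ) • b.smulRight a).range ≤ k := by
  by_cases hb : b = 0
  · have h0 : b.smulRight a = 0 := by ext; simp [hb]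
    rwa [h0, smul_zero, add_zero]
  obtain ⟨u, hu⟩ : ∃ u, b u ≠ 0 := by
    by_contra hno
    push Not at hno
    exact hb (LinearMap.ext hno)
  -- All maps on the line agree on `b.ker`, so their ranges contain `R` and exceed it by at most one
  -- dimension. If `R` has dimension below `k` there is room; otherwise the two given ranges equal
  -- `R`, and so the third lies in `R`.
  set R := Submodule.map f b.ker with hR
  have hsub : ∀ c : ℂ, R ≤ (f + c • b.smulRight a).range := by
    rintro c _ ⟨x, hx, rfl⟩
    refine ⟨x, ?_⟩
    have : b x = 0 := hx
    simp [this]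
  by_cases hlt : finrank ℂ R < k
  · have hle : (f + (2 : ℂ) • b.smulRight a).range ≤
        R ⊔ Submodule.span ℂ {(f + (2 : ℂ) • b.smulRight a) u} := by
      rintro _ ⟨x, rfl⟩
      have hx : x = (x - (b x / b u) • u) + (b x / b u) • u := by abel
      have hk : b (x - (b x / b u) • u) = 0 := by
        simp [div_mul_cancel₀ _ hu]
      rw [hx, map_add, map_smul]
      refine Submodule.add_mem_sup ⟨_, hk, ?_⟩
        (Submodule.smul_mem _ _ (Submodule.mem_span_singleton_self _))
      rw [LinearMap.add_apply, LinearMap.smul_apply, LinearMap.smulRight_apply, hk, zero_smul,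
        smul_zero, add_zero]
    have h1 := (Submodule.finrank_mono hle).trans
      (Submodule.finrank_add_le_finrank_add_finrank _ _)
    have h2 := finrank_span_le_card (R := ℂ) ({(f + (2 : ℂ) • b.smulRight a) u} : Set W)
    simp only [Set.toFinset_singleton, Finset.card_singleton] at h2
    omega
  · push Not at hlt
    have e0 : R = f.range := Submodule.eq_of_le_of_finrank_le (by simpa using hsub 0)
      (hf.trans hlt)
    have e1 : R = (f + b.smulRight a).range :=
      Submodule.eq_of_le_of_finrank_le (by simpa using hsub 1) (hfz.trans hlt)
    have hle : (f + (2 : ℂ) • b.smulRight a).range ≤ R := by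
      rintro _ ⟨x, rfl⟩
      have h1 : f x ∈ R := e0 ▸ ⟨x, rfl⟩
      have h2 : (f + b.smulRight a) x ∈ R := e1 ▸ ⟨x, rfl⟩
      have : (f + (2 : ℂ) • b.smulRight a) x = (2 : ℂ) • (f + b.smulRight a) x - f x := by
        simp only [LinearMap.add_apply, LinearMap.smul_apply]
        module
      rw [this]
      exact R.sub_mem (R.smul_mem _ h2) h1
    exact (Submodule.finrank_mono hle).trans (e0 ▸ hf)

/-- The converse: a direction of rank at least two is detected by a line on which two points have
rank at most `k` and a third one has a larger rank. -/
theorem exists_finrank_range_lt [FiniteDimensional ℂ W] {k : ℕ} (z : V →ₗ[ℂ] W)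
    (h2 : 2 ≤ finrank ℂ z.range) (hk : finrank ℂ z.range ≤ k) (hV : k < finrank ℂ V) (hW : k < finrank ℂ W) :
    ∃ v : V →ₗ[ℂ] W, finrank ℂ v.range ≤ k ∧ finrank ℂ (v + z).range ≤ k ∧
      k < finrank ℂ (v + (2 : ℂ) • z).range := by
  -- The rank that must be added to that of `z` to reach `k + 1`; it fits into `z.ker` and a
  -- complement of the range because both dimensions exceed `k`.
  obtain ⟨s, hs⟩ : ∃ s, s = k + 1 - finrank ℂ z.range := ⟨_, rfl⟩
  obtain ⟨R', hR'⟩ := Submodule.exists_isCompl z.range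
  have hsker : finrank ℂ (Fin s → ℂ) ≤ finrank ℂ z.ker := by
    have := z.finrank_range_add_finrank_ker
    rw [finrank_fin_fun]; omega
  have hsR' : finrank ℂ (Fin s → ℂ) ≤ finrank ℂ R' := by
    have := Submodule.finrank_add_eq_of_isCompl hR'
    rw [finrank_fin_fun]; omega
  obtain ⟨i, hi⟩ := finrank_le_iff_exists_linearMap.1 hsker
  obtain ⟨j, hj⟩ := finrank_le_iff_exists_linearMap.1 hsR'
  obtain ⟨p, hp⟩ := LinearMap.exists_leftInverse_of_injective (z.ker.subtype ∘ₗ i)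
    (LinearMap.ker_eq_bot.2 (z.ker.injective_subtype.comp hi))
  let q : (Fin s → ℂ) →ₗ[ℂ] W := R'.subtype ∘ₗ j
  have hq : Function.Injective q := R'.injective_subtype.comp hj
  have hqr : finrank ℂ q.range = s := by
    rw [LinearMap.finrank_range_of_inj hq, finrank_fin_fun]
  let N : V →ₗ[ℂ] W := q ∘ₗ p
  have hN : finrank ℂ N.range ≤ s := by
    rw [← hqr]
    exact Submodule.finrank_mono (LinearMap.range_comp_le_range _ _)
  obtain ⟨w, hw⟩ : ∃ w : z.range, w ≠ 0 := by
    by_contra hno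
    push Not at hno
    have : finrank ℂ z.range = 0 := finrank_zero_iff_forall_zero.2 hno
    omega
  obtain ⟨w, hwR⟩ := w
  replace hw : w ≠ 0 := fun h => hw (by simp [h])
  obtain ⟨l, hl⟩ : ∃ l : W →ₗ[ℂ] ℂ, l w = 1 := by
    obtain ⟨l, hl⟩ := LinearMap.exists_leftInverse_of_injective (LinearMap.toSpanSingleton ℂ W w)
      (LinearMap.ker_toSpanSingleton ℂ hw)
    exact ⟨l, by simpa using LinearMap.congr_fun hl 1⟩
  -- The first summand is `-P z` with `P` the projection onto `w` along `l.ker`. The ranks are at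
  -- most `1 + s ≤ k` for `v`, and at most `(rank z - 1) + s = k` for `v + z`, since `1 - P` has
  -- rank deficit one. For `v + 2z` the map `2 - P` is invertible on `z.range`, which gives `k + 1`.
  refine ⟨(l ∘ₗ z).smulRight (-w) + N, ?_, ?_, ?_⟩
  · have := finrank_range_add_le ((l ∘ₗ z).smulRight (-w)) N
    have := finrank_range_smulRight_le (l ∘ₗ z) (-w)
    omega
  · have hlt : ((l ∘ₗ z).smulRight (-w) + z).range < z.range := by
      refine lt_of_le_of_ne ?_ fun e => ?_
      · rintro _ ⟨x, rfl⟩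
        exact z.range.add_mem (z.range.smul_mem _ (z.range.neg_mem hwR)) ⟨x, rfl⟩
      · have hmem : w ∈ ((l ∘ₗ z).smulRight (-w) + z).range := by rw [e]; exact hwR
        obtain ⟨x, hx⟩ := hmem
        have := congrArg l hx
        simp [hl] at this
    have h1 := Submodule.finrank_lt_finrank_of_lt hlt
    have h3 := finrank_range_add_le ((l ∘ₗ z).smulRight (-w) + z) N
    rw [add_right_comm]
    omega
  · have hQ : q.range ≤ ((l ∘ₗ z).smulRight (-w) + N + (2 : ℂ) • z).range := by
      rintro _ ⟨x, rfl⟩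
      refine ⟨i x, ?_⟩
      have h0 : z (i x) = 0 := (i x).2
      have hpx : p (i x) = x := LinearMap.congr_fun hp x
      simp [h0, N, hpx]
    have hZ : z.range ≤ ((l ∘ₗ z).smulRight (-w) + N + (2 : ℂ) • z).range := by
      intro y hy
      -- The solution `u` of `2 u - l u • w = y`.
      have hmem : (2⁻¹ : ℂ) • y + (2⁻¹ * l y) • w ∈ z.range :=
        z.range.add_mem (z.range.smul_mem _ hy) (z.range.smul_mem _ hwR)
      obtain ⟨x, hx⟩ := hmem
      have e : y = ((l ∘ₗ z).smulRight (-w) + N + (2 : ℂ) • z) x - N x := by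
        simp only [LinearMap.add_apply, LinearMap.smul_apply, LinearMap.smulRight_apply,
          LinearMap.comp_apply, hx, map_add, map_smul, hl, smul_eq_mul]
        module
      rw [e]
      refine Submodule.sub_mem _ ⟨x, rfl⟩ (hQ ⟨p x, rfl⟩)
    have hdisj : z.range ⊓ q.range = ⊥ := by
      refine eq_bot_iff.2 (le_trans (inf_le_inf_left _ ?_) hR'.inf_eq_bot.le)
      rintro _ ⟨x, rfl⟩
      exact (j x).2
    have h1 := Submodule.finrank_sup_add_finrank_inf_eq z.range q.range
    rw [hdisj, finrank_bot] at h1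
    have h3 := Submodule.finrank_mono (sup_le hZ hQ)
    omega

end Rank

/-! ### Vectors with coefficient matrix of bounded rank -/

section LowRank

variable {m n k : ℕ}

/-- The coefficients of a vector of `ℂ^m ⊗ ℂ^n` as an `m × n` matrix. -/
def coeffMatrix (v : Fin m × Fin n → ℂ) : Matrix (Fin m) (Fin n) ℂ := Matrix.of fun i j => v (i, j)

@[simp] theorem coeffMatrix_apply (v : Fin m × Fin n → ℂ) (i : Fin m) (j : Fin n) :
    coeffMatrix v i j = v (i, j) := rfl

/-- The vectors whose matrix of coefficients has rank at most `k`. -/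
def LowRank (k : ℕ) (v : Fin m × Fin n → ℂ) : Prop := (coeffMatrix v).rank ≤ k

theorem LowRank.mono {l : ℕ} {v : Fin m × Fin n → ℂ} (h : LowRank k v) (hkl : k ≤ l) :
    LowRank l v := le_trans h hkl

theorem lowRank_zero : LowRank k (0 : Fin m × Fin n → ℂ) := by
  have : coeffMatrix (0 : Fin m × Fin n → ℂ) = 0 := rfl
  rw [LowRank, this, Matrix.rank_zero]; exact Nat.zero_le _

theorem LowRank.smul {v : Fin m × Fin n → ℂ} (h : LowRank k v) (c : ℂ) : LowRank k (c • v) := by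
  have : coeffMatrix (c • v) = (c • (1 : Matrix (Fin m) (Fin m) ℂ)) * coeffMatrix v := by
    ext i j; simp
  rw [LowRank, this]
  exact (Matrix.rank_mul_le_right _ _).trans h

theorem lowRank_sum {ι : Type*} [Fintype ι] (a : ι → Fin m → ℂ) (b : ι → Fin n → ℂ) :
    LowRank (Fintype.card ι) (fun p : Fin m × Fin n => ∑ l, a l p.1 * b l p.2) := by
  have : coeffMatrix (fun p : Fin m × Fin n => ∑ l, a l p.1 * b l p.2) =
      (Matrix.of fun i l => a l i) * (Matrix.of fun l j => b l j) := by
    ext i j; simp [Matrix.mul_apply]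
  rw [LowRank, this]
  exact (Matrix.rank_mul_le_left _ _).trans (Matrix.rank_le_card_width _)

theorem lowRank_mul (a : Fin m → ℂ) (b : Fin n → ℂ) :
    LowRank 1 (fun p : Fin m × Fin n => a p.1 * b p.2) := by
  simpa using lowRank_sum (fun _ : Unit => a) (fun _ => b)

/-- Expand the columns of the coefficient matrix in a basis of the column space. -/
theorem exists_sum_of_rank (v : Fin m × Fin n → ℂ) :
    ∃ (a : Fin (coeffMatrix v).rank → Fin m → ℂ) (b : Fin (coeffMatrix v).rank → Fin n → ℂ),
      v = fun p => ∑ l, a l p.1 * b l p.2 := by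
  let S := (coeffMatrix v).mulVecLin.range
  let e : Module.Basis (Fin (coeffMatrix v).rank) ℂ S := Module.finBasis ℂ S
  let c : Fin n → S := fun j => ⟨(coeffMatrix v).mulVecLin (Pi.single j 1), ⟨_, rfl⟩⟩
  refine ⟨fun l i => (e l : Fin m → ℂ) i, fun l j => e.repr (c j) l, ?_⟩
  funext ⟨i, j⟩
  have hc : (c j : Fin m → ℂ) i = v (i, j) := by simp [c]
  rw [← hc]
  conv_lhs => rw [← e.sum_repr (c j)]
  simp only [Submodule.coe_sum, Submodule.coe_smul, Finset.sum_apply, Pi.smul_apply, smul_eq_mul]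
  exact Finset.sum_congr rfl fun l _ => mul_comm _ _

theorem LowRank.exists_mul {v : Fin m × Fin n → ℂ} (h : LowRank 1 v) :
    ∃ (a : Fin m → ℂ) (b : Fin n → ℂ), v = fun p => a p.1 * b p.2 := by
  obtain ⟨a, b, hv⟩ := exists_sum_of_rank v
  rcases Nat.le_one_iff_eq_zero_or_eq_one.1 h with h0 | h1
  · have : IsEmpty (Fin (coeffMatrix v).rank) := by rw [h0]; infer_instance
    exact ⟨0, 0, by rw [hv]; funext p; simp⟩
  · have : Unique (Fin (coeffMatrix v).rank) := by rw [h1]; infer_instance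
    exact ⟨a default, b default, hv.trans (by funext p; simp)⟩

theorem LowRank.add_two_smul {v z : Fin m × Fin n → ℂ} (hv : LowRank k v) (hz : LowRank 1 z)
    (hvz : LowRank k (v + z)) : LowRank k (v + (2 : ℂ) • z) := by
  obtain ⟨a, b, rfl⟩ := hz.exists_mul
  let l : (Fin n → ℂ) →ₗ[ℂ] ℂ := ∑ j, b j • LinearMap.proj j
  have hl : (coeffMatrix fun p : Fin m × Fin n => a p.1 * b p.2).mulVecLin = l.smulRight a := by
    ext j i
    simp [l, Finset.sum_apply, Pi.single_apply, mul_comm]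
  have h2 : ∀ c : ℂ, (coeffMatrix (v + c • fun p : Fin m × Fin n => a p.1 * b p.2)).mulVecLin =
      (coeffMatrix v).mulVecLin + c • l.smulRight a := by
    intro c
    rw [← hl]
    ext j i
    simp
  have h1 := h2 1
  rw [one_smul, one_smul] at h1
  unfold LowRank Matrix.rank at *
  rw [h1] at hvz
  rw [h2]
  exact finrank_range_add_two_smul_le _ _ _ hv hvz

theorem exists_not_lowRank {z : Fin m × Fin n → ℂ} (hz : LowRank k z) (hz1 : ¬ LowRank 1 z)
    (hm : k < m) (hn : k < n) : ∃ v : Fin m × Fin n → ℂ, LowRank k v ∧ LowRank k (v + z) ∧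
      ¬ LowRank k (v + (2 : ℂ) • z) := by
  obtain ⟨f, h1, h2, h3⟩ := exists_finrank_range_lt (coeffMatrix z).mulVecLin
    (not_le.1 hz1) hz (by simpa using hn) (by simpa using hm)
  let v : Fin m × Fin n → ℂ := fun p => LinearMap.toMatrix' f p.1 p.2
  have e : ∀ c : ℂ, (coeffMatrix (v + c • z)).mulVecLin = f + c • (coeffMatrix z).mulVecLin := by
    intro c
    have : coeffMatrix (v + c • z) = LinearMap.toMatrix' f + c • coeffMatrix z := rfl
    rw [this, Matrix.mulVecLin_add, ← Matrix.toLin'_apply', Matrix.toLin'_toMatrix']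
    congr 1
    ext j i
    simp
  have e0 := e 0
  have e1 := e 1
  rw [zero_smul, zero_smul, add_zero, add_zero] at e0
  rw [one_smul, one_smul] at e1
  refine ⟨v, ?_, ?_, ?_⟩ <;> unfold LowRank Matrix.rank
  · rwa [e0]
  · rwa [e1]
  · rw [e]; exact not_le.2 h3

/-- Rank above `k` means that some `k + 1` vectors have linearly independent images, which is an
open condition for each choice of these vectors. -/
theorem isClosed_lowRank : IsClosed {v : Fin m × Fin n → ℂ | LowRank k v} := by
  have : {v : Fin m × Fin n → ℂ | LowRank k v} =
      (⋃ w : Fin (k + 1) → Fin n → ℂ, {v : Fin m × Fin n → ℂ |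
        LinearIndependent ℂ fun l => (coeffMatrix v).mulVec (w l)})ᶜ := by
    ext v
    simp only [Set.mem_ofPred_eq, Set.mem_compl_iff, Set.mem_iUnion, not_exists]
    constructor
    · intro h w hw
      have hli : LinearIndependent ℂ fun l =>
          (⟨(coeffMatrix v).mulVecLin (w l), ⟨_, rfl⟩⟩ : (coeffMatrix v).mulVecLin.range) :=
        LinearIndependent.of_comp (Submodule.subtype _) hw
      have h1 := hli.fintype_card_le_finrank
      have h2 : Module.finrank ℂ (coeffMatrix v).mulVecLin.range ≤ k := h
      simp only [Fintype.card_fin] at h1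
      omega
    · intro h
      by_contra hlt
      have hlt' : k + 1 ≤ Module.finrank ℂ (coeffMatrix v).mulVecLin.range := not_le.1 hlt
      have hfin : Module.finrank ℂ (Fin (k + 1) → ℂ) ≤
          Module.finrank ℂ (coeffMatrix v).mulVecLin.range := by simpa using hlt'
      obtain ⟨i, hi⟩ := _root_.finrank_le_iff_exists_linearMap.1 hfin
      choose w hw using fun l : Fin (k + 1) => (i (Pi.single l 1)).2
      refine h w ?_
      have hb := (Pi.basisFun ℂ (Fin (k + 1))).linearIndependent.map'
        ((coeffMatrix v).mulVecLin.range.subtype ∘ₗ i)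
        (LinearMap.ker_eq_bot.2 ((Submodule.injective_subtype _).comp hi))
      have e : (fun l => (coeffMatrix v).mulVec (w l)) =
          ((coeffMatrix v).mulVecLin.range.subtype ∘ₗ i) ∘ Pi.basisFun ℂ (Fin (k + 1)) := by
        funext l
        simpa using hw l
      rw [e]
      exact hb
  rw [this]
  refine (isOpen_iUnion fun w => ?_).isClosed_compl
  refine (isOpen_setOfPred_linearIndependent (𝕜 := ℂ) (E := Fin m → ℂ)).preimage
    (f := fun (v : Fin m × Fin n → ℂ) l => (coeffMatrix v).mulVec (w l)) ?_
  refine continuous_pi fun l => continuous_pi fun i => ?_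
  simp only [Matrix.mulVec, dotProduct, coeffMatrix_apply]
  fun_prop

end LowRank

/-! ### Linear characterization of product operators -/

section LowRankOps

open Matrix

variable {m n k : ℕ}

/-- The operators `v w^T` with `v` and `w` of rank at most `k`. -/
def LowRankOp (k : ℕ) (X : Op m n) : Prop :=
  ∃ v w, LowRank k v ∧ LowRank k w ∧ X = vecMulVec v w

theorem LowRankOp.left {v w : Fin m × Fin n → ℂ} (h : LowRankOp k (vecMulVec v w)) (hw : w ≠ 0) :
    LowRank k v := by
  obtain ⟨p, q, hp, -, e⟩ := h
  obtain ⟨s, hs⟩ := Function.ne_iff.1 hw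
  simp only [Pi.zero_apply] at hs
  have : v = (q s / w s) • p := by
    funext r
    have := congrFun (congrFun e r) s
    simp only [vecMulVec_apply] at this
    simp only [Pi.smul_apply, smul_eq_mul]
    field_simp
    linear_combination this
  rw [this]
  exact hp.smul _

theorem LowRankOp.transpose {X : Op m n} (h : LowRankOp k X) : LowRankOp k Xᵀ := by
  obtain ⟨p, q, hp, hq, rfl⟩ := h
  exact ⟨q, p, hq, hp, transpose_vecMulVec _ _⟩

theorem LowRankOp.right {v w : Fin m × Fin n → ℂ} (h : LowRankOp k (vecMulVec v w)) (hv : v ≠ 0) :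
    LowRank k w := by
  have := h.transpose
  rw [transpose_vecMulVec] at this
  exact this.left hv

theorem LowRankOp.mono {l : ℕ} {X : Op m n} (h : LowRankOp k X) (hkl : k ≤ l) : LowRankOp l X := by
  obtain ⟨p, q, hp, hq, rfl⟩ := h
  exact ⟨p, q, hp.mono hkl, hq.mono hkl, rfl⟩

/-- Since `Y + Z` has operator rank at most one, `Y` and `Z` can be written with a common left or a
common right factor. The line then moves a single factor in a direction of Schmidt rank at most one,
where `LowRank.add_two_smul` applies. -/
theorem LowRankOp.add_two_smul {Y Z : Op m n} (hk : 1 ≤ k) (hY : LowRankOp k Y)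
    (hZ : LowRankOp 1 Z) (hYZ : LowRankOp k (Y + Z)) : LowRankOp k (Y + (2 : ℂ) • Z) := by
  obtain ⟨v, u, hv, hu, rfl⟩ := hY
  obtain ⟨z, w, hz, hw, rfl⟩ := hZ
  by_cases hz0 : z = 0
  · subst hz0
    simp only [zero_vecMulVec, smul_zero, add_zero]
    exact ⟨v, u, hv, hu, rfl⟩
  by_cases hw0 : w = 0
  · subst hw0
    simp only [vecMulVec_zero, smul_zero, add_zero]
    exact ⟨v, u, hv, hu, rfl⟩
  by_cases hdet : ∃ s t, v s * z t - v t * z s ≠ 0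
  · obtain ⟨s, t, hdet⟩ := hdet
    obtain ⟨p, q, hp, hq, e⟩ := id hYZ
    obtain ⟨⟨c, hc⟩, c', hc'⟩ := exists_smul_of_add_eq_mul (q := u) (q' := w) (v := p) (w := q) hdet
      (fun i j => by simpa [vecMulVec_apply] using congrFun (congrFun e i) j)
    have hc0 : c' ≠ 0 := fun h0 => hw0 (by rw [hc', h0, zero_smul])
    have hu' : u = (c * c'⁻¹) • w := by
      rw [hc', smul_smul, mul_assoc, inv_mul_cancel₀ hc0, mul_one, hc]
    have e1 : ∀ a : ℂ, vecMulVec v u + a • vecMulVec z w =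
        vecMulVec ((c * c'⁻¹) • v + a • z) w := by
      intro a
      rw [hu']
      ext i j
      simp [vecMulVec_apply]; ring
    have h1 := e1 1
    rw [one_smul, one_smul] at h1
    rw [h1] at hYZ
    rw [e1]
    exact ⟨_, w, (hv.smul _).add_two_smul hz (hYZ.left hw0), hw.mono hk, rfl⟩
  · push Not at hdet
    obtain ⟨c, rfl⟩ := exists_smul_of_minors (q := v) hz0 fun s t => by
      linear_combination - hdet s t
    have e1 : ∀ a : ℂ, vecMulVec (c • z) u + a • vecMulVec z w = vecMulVec z (c • u + a • w) := by
      intro a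
      ext i j
      simp [vecMulVec_apply]; ring
    have h1 := e1 1
    rw [one_smul, one_smul] at h1
    rw [h1] at hYZ
    rw [e1]
    exact ⟨z, _, hz.mono hk, (hu.smul _).add_two_smul hw (hYZ.right hz0), rfl⟩

/-- Test only against `Y = v w^T` with the same `w`; a violating `v` is the one from
`exists_not_lowRank`. The right factor is handled afterwards by transposing. -/
theorem lowRank_one_of_forall {z w : Fin m × Fin n → ℂ} (hm : k < m) (hn : k < n)
    (hz : LowRank k z) (hw : LowRank k w) (hw0 : w ≠ 0)
    (h : ∀ Y : Op m n, LowRankOp k Y → LowRankOp k (Y + vecMulVec z w) →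
      LowRankOp k (Y + (2 : ℂ) • vecMulVec z w)) : LowRank 1 z := by
  by_contra hz1
  obtain ⟨v, h1, h2, h3⟩ := exists_not_lowRank hz hz1 hm hn
  have := h (vecMulVec v w) ⟨v, w, h1, hw, rfl⟩ (by
    rw [← add_vecMulVec]; exact ⟨_, w, h2, hw, rfl⟩)
  rw [← smul_vecMulVec, ← add_vecMulVec] at this
  exact h3 (this.left hw0)

theorem LowRankOp.one_of_forall {Z : Op m n} (hm : k < m) (hn : k < n) (hZ : LowRankOp k Z)
    (h : ∀ Y : Op m n, LowRankOp k Y → LowRankOp k (Y + Z) → LowRankOp k (Y + (2 : ℂ) • Z)) :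
    LowRankOp 1 Z := by
  obtain ⟨z, w, hz, hw, rfl⟩ := hZ
  by_cases hz0 : z = 0
  · exact ⟨0, 0, lowRank_zero, lowRank_zero, by simp [hz0]⟩
  by_cases hw0 : w = 0
  · exact ⟨0, 0, lowRank_zero, lowRank_zero, by simp [hw0]⟩
  refine ⟨z, w, lowRank_one_of_forall hm hn hz hw hw0 h,
    lowRank_one_of_forall hm hn hw hz hz0 fun Y hY hYZ => ?_, rfl⟩
  have e : vecMulVec w z = (vecMulVec z w)ᵀ := (transpose_vecMulVec _ _).symm
  have := h Yᵀ hY.transpose (by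
    have := hYZ.transpose
    rwa [e, transpose_add, transpose_transpose] at this)
  have := this.transpose
  rwa [transpose_add, transpose_transpose, transpose_smul, ← e] at this

/-- A linear bijection that preserves the operators `v w^T` with `v`, `w` of rank at most `k` also
preserves those with `v`, `w` of rank at most one. -/
theorem LowRankOp.map_one (hk : 1 ≤ k) (hm : k < m) (hn : k < n) (Φ : Op m n ≃ₗ[ℂ] Op m n)
    (h : ∀ X, LowRankOp k X → LowRankOp k (Φ X))
    (h' : ∀ X, LowRankOp k X → LowRankOp k (Φ.symm X)) {X : Op m n} (hX : LowRankOp 1 X) :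
    LowRankOp 1 (Φ X) := by
  -- The criterion mentions only the linear structure and the cone, so it is pulled back by `Φ.symm`
  -- and pushed forward by `Φ`.
  refine (h _ (hX.mono hk)).one_of_forall hm hn fun Y hY hYX => ?_
  have h1 := h' _ hYX
  rw [map_add, LinearEquiv.symm_apply_apply] at h1
  have h2 := h _ ((h' _ hY).add_two_smul hk hX h1)
  rwa [map_add, map_smul, LinearEquiv.apply_symm_apply] at h2

end LowRankOps

open Matrix

/-! ### Unit operators and the Frobenius norm -/

section UnitOp

variable {m n k : ℕ}

/-- The squared Euclidean norm. -/
def sqNorm {α : Type*} [Fintype α] (v : α → ℂ) : ℝ := ∑ p, ‖v p‖ ^ 2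

theorem sqNorm_nonneg {α : Type*} [Fintype α] (v : α → ℂ) : 0 ≤ sqNorm v :=
  Finset.sum_nonneg fun _ _ => sq_nonneg _

theorem sqNorm_pos {α : Type*} [Fintype α] {v : α → ℂ} (hv : v ≠ 0) : 0 < sqNorm v := by
  obtain ⟨s, hs⟩ := Function.ne_iff.1 hv
  exact Finset.sum_pos' (fun _ _ => sq_nonneg _) ⟨s, Finset.mem_univ _, by
    have : 0 < ‖v s‖ := norm_pos_iff.2 hs
    positivity⟩

theorem sqNorm_smul {α : Type*} [Fintype α] (c : ℂ) (v : α → ℂ) :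
    sqNorm (c • v) = ‖c‖ ^ 2 * sqNorm v := by
  simp [sqNorm, mul_pow, Finset.mul_sum]

theorem sqNorm_mul {α β : Type*} [Fintype α] [Fintype β] (a : α → ℂ) (b : β → ℂ) :
    sqNorm (fun p : α × β => a p.1 * b p.2) = sqNorm a * sqNorm b := by
  simp only [sqNorm, norm_mul, mul_pow, Finset.sum_mul_sum, Fintype.sum_prod_type]

theorem ofReal_sqNorm {α : Type*} [Fintype α] (v : α → ℂ) : (sqNorm v : ℂ) = star v ⬝ᵥ v := by
  simp [sqNorm, dotProduct, ← Complex.conj_mul']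

theorem sqNorm_mulVec {α : Type*} [Fintype α] [DecidableEq α] {U : Matrix α α ℂ}
    (hU : U ∈ unitaryGroup α ℂ) (v : α → ℂ) : sqNorm (U *ᵥ v) = sqNorm v := by
  have h : ((sqNorm (U *ᵥ v) : ℝ) : ℂ) = (sqNorm v : ℂ) := by
    rw [ofReal_sqNorm, ofReal_sqNorm, star_mulVec, ← dotProduct_mulVec, mulVec_mulVec,
      ← star_eq_conjTranspose, mem_unitaryGroup_iff'.1 hU, one_mulVec]
  exact_mod_cast h

/-- The operators `v w^T` with unit vectors `v`, `w` of Schmidt rank at most `k`. -/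
def unitOps (m n k : ℕ) : Set (Op m n) :=
  {X | ∃ v w, sqNorm v = 1 ∧ sqNorm w = 1 ∧ LowRank k v ∧ LowRank k w ∧ X = vecMulVec v w}

/-- The squared Frobenius norm. -/
def frobSq (X : Op m n) : ℝ := ∑ p, ∑ q, ‖X p q‖ ^ 2

theorem frobSq_vecMulVec (v w : Fin m × Fin n → ℂ) :
    frobSq (vecMulVec v w) = sqNorm v * sqNorm w := by
  simp only [frobSq, sqNorm, vecMulVec_apply, norm_mul, mul_pow, Finset.sum_mul_sum]

theorem frobSq_smul (c : ℂ) (X : Op m n) : frobSq (c • X) = ‖c‖ ^ 2 * frobSq X := by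
  simp [frobSq, mul_pow, Finset.mul_sum]

theorem frobSq_of_mem_unitOps {X : Op m n} (hX : X ∈ unitOps m n k) : frobSq X = 1 := by
  obtain ⟨v, w, hv, hw, -, -, rfl⟩ := hX
  rw [frobSq_vecMulVec, hv, hw, one_mul]

theorem lowRank_single (hk : 1 ≤ k) (p : Fin m × Fin n) :
    LowRank k (Pi.single p 1 : Fin m × Fin n → ℂ) := by
  have : (Pi.single p 1 : Fin m × Fin n → ℂ) = fun q =>
      (Pi.single p.1 1 : Fin m → ℂ) q.1 * (Pi.single p.2 1 : Fin n → ℂ) q.2 := by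
    funext q
    simp only [Pi.single_apply, Prod.ext_iff]
    split_ifs <;> simp_all
  rw [this]
  exact (lowRank_mul _ _).mono hk

theorem sqNorm_single {α : Type*} [Fintype α] [DecidableEq α] (p : α) :
    sqNorm (Pi.single p 1 : α → ℂ) = 1 := by
  rw [sqNorm, Finset.sum_eq_single p]
  · simp
  · intro q _ hq; simp [hq]
  · simp

theorem single_mem_unitOps (hk : 1 ≤ k) (p q : Fin m × Fin n) :
    Matrix.single p q (1 : ℂ) ∈ unitOps m n k :=
  ⟨Pi.single p 1, Pi.single q 1, sqNorm_single p, sqNorm_single q, lowRank_single hk p,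
    lowRank_single hk q, by
      ext i j
      simp only [Matrix.single_apply, vecMulVec_apply, Pi.single_apply]
      split_ifs <;> simp_all⟩

theorem exists_smul_unit {v : Fin m × Fin n → ℂ} (hv : LowRank k v) (hv0 : v ≠ 0) :
    ∃ (c : ℂ) (u : Fin m × Fin n → ℂ), sqNorm u = 1 ∧ LowRank k u ∧ v = c • u := by
  have h := sqNorm_pos hv0
  have hs : ((Real.sqrt (sqNorm v) : ℝ) : ℂ) ≠ 0 :=
    Complex.ofReal_ne_zero.2 (Real.sqrt_ne_zero'.2 h)
  refine ⟨(Real.sqrt (sqNorm v) : ℝ), ((Real.sqrt (sqNorm v) : ℝ) : ℂ)⁻¹ • v, ?_, hv.smul _, ?_⟩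
  · rw [sqNorm_smul, norm_inv, Complex.norm_real, Real.norm_eq_abs, inv_pow, sq_abs,
      Real.sq_sqrt h.le, inv_mul_cancel₀ h.ne']
  · rw [smul_smul, mul_inv_cancel₀ hs, one_smul]

theorem LowRankOp.exists_smul {X : Op m n} (hX : LowRankOp k X) :
    X = 0 ∨ ∃ (c : ℂ), ∃ Y ∈ unitOps m n k, X = c • Y := by
  obtain ⟨v, w, hv, hw, rfl⟩ := hX
  by_cases hv0 : v = 0
  · left; simp [hv0]
  by_cases hw0 : w = 0
  · left; simp [hw0]
  obtain ⟨c, u, hu, hku, rfl⟩ := exists_smul_unit hv hv0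
  obtain ⟨d, z, hz, hkz, rfl⟩ := exists_smul_unit hw hw0
  exact Or.inr ⟨c * d, _, ⟨u, z, hu, hz, hku, hkz, rfl⟩, by
    rw [smul_vecMulVec, vecMulVec_smul, smul_smul]⟩

theorem lowRankOp_smul_of_mem {X : Op m n} (hX : X ∈ unitOps m n k) (c : ℂ) :
    LowRankOp k (c • X) := by
  obtain ⟨v, w, -, -, hv, hw, rfl⟩ := hX
  exact ⟨c • v, w, hv.smul c, hw, (smul_vecMulVec _ _ _).symm⟩

theorem LowRankOp.map {Φ : Op m n →ₗ[ℂ] Op m n} (h : ∀ X ∈ unitOps m n k, Φ X ∈ unitOps m n k)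
    {X : Op m n} (hX : LowRankOp k X) : LowRankOp k (Φ X) := by
  rcases hX.exists_smul with rfl | ⟨c, Y, hY, rfl⟩
  · rw [map_zero]; exact hX
  · rw [map_smul]; exact lowRankOp_smul_of_mem (h Y hY) c

/-- The cone consists of zero and multiples of unit operators, all of Frobenius norm one. This is
the source of unitarity later. -/
theorem LowRankOp.frobSq_map {Φ : Op m n →ₗ[ℂ] Op m n}
    (h : ∀ X ∈ unitOps m n k, Φ X ∈ unitOps m n k) {X : Op m n} (hX : LowRankOp k X) :
    frobSq (Φ X) = frobSq X := by
  rcases hX.exists_smul with rfl | ⟨c, Y, hY, rfl⟩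
  · rw [map_zero]
  · rw [map_smul, frobSq_smul, frobSq_smul, frobSq_of_mem_unitOps (h Y hY),
      frobSq_of_mem_unitOps hY]

theorem smul_mem_unitOps {X : Op m n} (hX : X ∈ unitOps m n k) {c : ℂ} (hc : ‖c‖ = 1) :
    c • X ∈ unitOps m n k := by
  obtain ⟨v, w, hv, hw, hkv, hkw, rfl⟩ := hX
  exact ⟨c • v, w, by rw [sqNorm_smul, hc, hv]; norm_num, hw, hkv.smul c, hkw,
    (smul_vecMulVec _ _ _).symm⟩

end UnitOp

/-! ### Local unitaries and the swap -/

section LocalUnitary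

variable {m n k : ℕ}

theorem swapOp_mul_apply (X : Op n n) (p q : Fin n × Fin n) :
    ((swapOp rfl : Op n n) * X) p q = X (p.2, p.1) q := by
  rw [Matrix.mul_apply, Finset.sum_eq_single (p.2, p.1)]
  · simp [swapOp]
  · intro r _ hr
    have : ¬ p = (r.2, r.1) := fun h => hr (by simp [h])
    simp [swapOp, this]
  · simp

theorem mul_swapOp_apply (X : Op n n) (p q : Fin n × Fin n) :
    (X * (swapOp rfl : Op n n)) p q = X p (q.2, q.1) := by
  rw [Matrix.mul_apply, Finset.sum_eq_single (q.2, q.1)]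
  · simp [swapOp]
  · intro r _ hr
    simp [swapOp, hr]
  · simp

theorem swapOp_transpose : (swapOp rfl : Op n n)ᵀ = swapOp rfl := by
  ext p q
  simp only [swapOp, transpose_apply, of_apply, Fin.cast_eq_self]
  congr 1
  simp only [Prod.ext_iff, eq_iff_iff]
  constructor <;> rintro ⟨h1, h2⟩ <;> exact ⟨h2.symm, h1.symm⟩

theorem swapOp_conjTranspose : (swapOp rfl : Op n n)ᴴ = swapOp rfl := by
  conv_rhs => rw [← swapOp_transpose]
  ext p q
  simp only [swapOp, conjTranspose_apply, transpose_apply, of_apply]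
  split_ifs <;> simp

theorem swapOp_mul_swapOp : (swapOp rfl : Op n n) * swapOp rfl = 1 := by
  ext p q
  rw [swapOp_mul_apply]
  simp only [swapOp, of_apply, Fin.cast_eq_self, one_apply]
  congr 1
  simp only [Prod.ext_iff, eq_iff_iff]
  exact and_comm

theorem kronecker_mul_swapOp (A B : Matrix (Fin n) (Fin n) ℂ) :
    (A ⊗ₖ B : Op n n) * swapOp rfl = swapOp rfl * (B ⊗ₖ A) := by
  ext p q
  rw [mul_swapOp_apply, swapOp_mul_apply]
  simp [kroneckerMap_apply, mul_comm]

theorem IsLocalUnitary.transpose {U : Op m n} (h : IsLocalUnitary U) : IsLocalUnitary Uᵀ := by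
  have ht : ∀ {r : ℕ} {A : Matrix (Fin r) (Fin r) ℂ}, A ∈ unitaryGroup (Fin r) ℂ →
      Aᵀ ∈ unitaryGroup (Fin r) ℂ := by
    intro r A hA
    rw [mem_unitaryGroup_iff] at *
    have : star Aᵀ = (star A)ᵀ := rfl
    rw [this, ← transpose_mul]
    rw [mul_eq_one_comm] at hA
    rw [hA, transpose_one]
  obtain ⟨A, hA, B, hB, h | ⟨e, h⟩⟩ := h
  · exact ⟨Aᵀ, ht hA, Bᵀ, ht hB, Or.inl (by rw [h, kroneckerMap_transpose])⟩
  · subst e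
    refine ⟨Bᵀ, ht hB, Aᵀ, ht hA, Or.inr ⟨rfl, ?_⟩⟩
    rw [h, transpose_mul, swapOp_transpose, ← kroneckerMap_transpose, kronecker_mul_swapOp]

theorem IsLocalUnitary.star {U : Op m n} (h : IsLocalUnitary U) : IsLocalUnitary (star U) := by
  obtain ⟨A, hA, B, hB, h | ⟨e, h⟩⟩ := h
  · exact ⟨Star.star A, Unitary.star_mem hA, Star.star B, Unitary.star_mem hB, Or.inl (by
      rw [h, star_eq_conjTranspose, conjTranspose_kronecker]; rfl)⟩
  · subst e
    refine ⟨Star.star B, Unitary.star_mem hB, Star.star A, Unitary.star_mem hA, Or.inr ⟨rfl, ?_⟩⟩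
    rw [h, star_eq_conjTranspose, conjTranspose_mul, swapOp_conjTranspose,
      conjTranspose_kronecker, kronecker_mul_swapOp]
    rfl

theorem IsLocalUnitary.mem_unitaryGroup {U : Op m n} (h : IsLocalUnitary U) :
    U ∈ unitaryGroup (Fin m × Fin n) ℂ := by
  obtain ⟨A, hA, B, hB, h | ⟨e, h⟩⟩ := h
  · rw [h]; exact kronecker_mem_unitary hA hB
  · subst e
    rw [h]
    refine Submonoid.mul_mem _ ?_ (kronecker_mem_unitary hA hB)
    rw [mem_unitaryGroup_iff, star_eq_conjTranspose, swapOp_conjTranspose, swapOp_mul_swapOp]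

theorem isLocalUnitary_one : IsLocalUnitary (1 : Op m n) :=
  ⟨1, one_mem _, 1, one_mem _, Or.inl (by simp)⟩

theorem isLocalUnitary_swapOp : IsLocalUnitary (swapOp rfl : Op n n) :=
  ⟨1, one_mem _, 1, one_mem _, Or.inr ⟨rfl, by simp⟩⟩

theorem coeffMatrix_kronecker_mulVec (A : Matrix (Fin m) (Fin m) ℂ) (B : Matrix (Fin n) (Fin n) ℂ)
    (v : Fin m × Fin n → ℂ) : coeffMatrix ((A ⊗ₖ B) *ᵥ v) = A * coeffMatrix v * Bᵀ := by
  ext i j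
  simp only [coeffMatrix_apply, mulVec, dotProduct, kroneckerMap_apply, Matrix.mul_apply,
    transpose_apply, Fintype.sum_prod_type, Finset.sum_mul]
  rw [Finset.sum_comm]
  exact Finset.sum_congr rfl fun _ _ => Finset.sum_congr rfl fun _ _ => by ring

theorem LowRank.kronecker_mulVec {v : Fin m × Fin n → ℂ} (hv : LowRank k v)
    (A : Matrix (Fin m) (Fin m) ℂ) (B : Matrix (Fin n) (Fin n) ℂ) :
    LowRank k ((A ⊗ₖ B) *ᵥ v) := by
  rw [LowRank, coeffMatrix_kronecker_mulVec]
  exact (rank_mul_le_left _ _).trans ((rank_mul_le_right _ _).trans hv)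

theorem swapOp_mulVec (v : Fin n × Fin n → ℂ) : swapOp rfl *ᵥ v = fun p => v (p.2, p.1) := by
  funext p
  have : swapOp rfl *ᵥ v = fun p => (swapOp rfl * Matrix.of fun r _ => v r : Op n n) p p := by
    funext r
    simp [Matrix.mul_apply, mulVec, dotProduct]
  rw [this]
  simp only [swapOp_mul_apply, of_apply]

theorem LowRank.swapOp_mulVec {v : Fin n × Fin n → ℂ} (hv : LowRank k v) :
    LowRank k (swapOp rfl *ᵥ v) := by
  have : coeffMatrix (swapOp rfl *ᵥ v) = (coeffMatrix v)ᵀ := by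
    rw [EntNorm.swapOp_mulVec]; rfl
  rw [LowRank, this, rank_transpose]
  exact hv

/-- On coefficient matrices `A ⊗ B` acts as `M ↦ A M Bᵀ` and the swap as transposition; neither
raises the rank. -/
theorem IsLocalUnitary.lowRank_mulVec {U : Op m n} (h : IsLocalUnitary U)
    {v : Fin m × Fin n → ℂ} (hv : LowRank k v) : LowRank k (U *ᵥ v) := by
  obtain ⟨A, hA, B, hB, h | ⟨e, h⟩⟩ := h
  · rw [h]; exact hv.kronecker_mulVec A B
  · subst e
    rw [h, ← mulVec_mulVec]
    exact (hv.kronecker_mulVec A B).swapOp_mulVec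

end LocalUnitary

/-! ### Generators: invariance, inverses and transposes -/

section Generators

variable {m n k : ℕ}

/-- The bilinear pairing `∑ X_{pq} Y_{pq}`. -/
def pairing (X Y : Op m n) : ℂ := trace (Xᵀ * Y)

theorem pairing_eq_sum (X Y : Op m n) : pairing X Y = ∑ p, ∑ q, X p q * Y p q := by
  simp only [pairing, trace, diag_apply, Matrix.mul_apply, transpose_apply]
  exact Finset.sum_comm

theorem partialTranspose_partialTranspose (X : Op m n) :
    partialTranspose (partialTranspose X) = X := by
  ext p q; simp [partialTranspose]

/-- For product vectors the partial transpose exchanges `b` and `d`. The new factors need not be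
unit vectors separately, but the product of their norms is one, so the result is a unit operator up
to a phase. -/
theorem partialTranspose_mem_unitOps {X : Op m n} (hX : X ∈ unitOps m n 1) :
    partialTranspose X ∈ unitOps m n 1 := by
  obtain ⟨v, w, hv, hw, hkv, hkw, rfl⟩ := hX
  obtain ⟨a, b, rfl⟩ := hkv.exists_mul
  obtain ⟨c, d, rfl⟩ := hkw.exists_mul
  have hf := frobSq_vecMulVec (fun p : Fin m × Fin n => a p.1 * d p.2) fun p => c p.1 * b p.2
  have e : partialTranspose (vecMulVec (fun p : Fin m × Fin n => a p.1 * b p.2)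
      fun p => c p.1 * d p.2) = vecMulVec (fun p => a p.1 * d p.2) fun p => c p.1 * b p.2 := by
    ext p q
    simp only [partialTranspose, of_apply, vecMulVec_apply]
    ring
  rw [e]
  set P := vecMulVec (fun p : Fin m × Fin n => a p.1 * d p.2)
    (fun p : Fin m × Fin n => c p.1 * b p.2)
  have hlow : LowRankOp 1 P := ⟨_, _, lowRank_mul a d, lowRank_mul c b, rfl⟩
  have h1 : frobSq P = 1 := by
    rw [hf, sqNorm_mul, sqNorm_mul]
    rw [sqNorm_mul] at hv hw
    linear_combination hv * sqNorm c * sqNorm d + hw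
  rcases hlow.exists_smul with h0 | ⟨r, Y, hY, hPY⟩
  · rw [h0] at h1
    simp [frobSq] at h1
  · rw [hPY, frobSq_smul, frobSq_of_mem_unitOps hY, mul_one] at h1
    rw [hPY]
    refine smul_mem_unitOps hY ?_
    have := norm_nonneg r
    nlinarith

theorem generators_mem_unitOps {Φ : Module.End ℂ (Op m n)} (hΦ : Φ ∈ generators m n k)
    {X : Op m n} (hX : X ∈ unitOps m n k) : Φ X ∈ unitOps m n k := by
  rcases hΦ with ⟨U, V, hU, hV, h⟩ | h | ⟨rfl, h⟩
  · obtain ⟨v, w, hv, hw, hkv, hkw, rfl⟩ := hX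
    refine ⟨U *ᵥ v, Vᵀ *ᵥ w, ?_, ?_, hU.lowRank_mulVec hkv, hV.transpose.lowRank_mulVec hkw, ?_⟩
    · rw [sqNorm_mulVec hU.mem_unitaryGroup, hv]
    · rw [sqNorm_mulVec hV.transpose.mem_unitaryGroup, hw]
    · rw [h, mul_vecMulVec, vecMulVec_mul, mulVec_transpose]
  · obtain ⟨v, w, hv, hw, hkv, hkw, rfl⟩ := hX
    exact ⟨w, v, hw, hv, hkw, hkv, by rw [h, transpose_vecMulVec]⟩
  · rw [h]; exact partialTranspose_mem_unitOps hX

theorem closure_mem_unitOps {Φ : Module.End ℂ (Op m n)}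
    (hΦ : Φ ∈ Subsemigroup.closure (generators m n k)) :
    ∀ X ∈ unitOps m n k, Φ X ∈ unitOps m n k := by
  induction hΦ using Subsemigroup.closure_induction with
  | mem Φ h => exact fun X hX => generators_mem_unitOps h hX
  | mul Φ Ψ _ _ h1 h2 => exact fun X hX => h1 _ (h2 _ hX)

theorem generators_exists_inverse {Φ : Module.End ℂ (Op m n)} (hΦ : Φ ∈ generators m n k) :
    ∃ Ψ ∈ generators m n k, Φ * Ψ = 1 ∧ Ψ * Φ = 1 := by
  rcases hΦ with ⟨U, V, hU, hV, h⟩ | h | ⟨hk, h⟩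
  · have hU1 := mem_unitaryGroup_iff.1 hU.mem_unitaryGroup
    have hU2 := mem_unitaryGroup_iff'.1 hU.mem_unitaryGroup
    have hV1 := mem_unitaryGroup_iff.1 hV.mem_unitaryGroup
    have hV2 := mem_unitaryGroup_iff'.1 hV.mem_unitaryGroup
    refine ⟨LinearMap.mulLeft ℂ (star U) * LinearMap.mulRight ℂ (star V),
      Or.inl ⟨star U, star V, hU.star, hV.star, fun X => by simp [mul_assoc]⟩, ?_, ?_⟩
    · refine LinearMap.ext fun X => ?_
      simp only [Module.End.mul_apply, LinearMap.mulLeft_apply, LinearMap.mulRight_apply, h,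
        Module.End.one_apply]
      rw [← mul_assoc U, hU1, one_mul, mul_assoc, hV2, mul_one]
    · refine LinearMap.ext fun X => ?_
      simp only [Module.End.mul_apply, LinearMap.mulLeft_apply, LinearMap.mulRight_apply, h,
        Module.End.one_apply]
      rw [mul_assoc (U * X), hV1, mul_one, ← mul_assoc, hU2, one_mul]
  · refine ⟨Φ, Or.inr (Or.inl h), ?_, ?_⟩ <;>
    exact LinearMap.ext fun X => by simp [h]
  · refine ⟨Φ, Or.inr (Or.inr ⟨hk, h⟩), ?_, ?_⟩ <;>
    exact LinearMap.ext fun X => by simp [h, partialTranspose_partialTranspose]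

theorem closure_exists_inverse {Φ : Module.End ℂ (Op m n)}
    (hΦ : Φ ∈ Subsemigroup.closure (generators m n k)) :
    ∃ Ψ ∈ Subsemigroup.closure (generators m n k), Φ * Ψ = 1 ∧ Ψ * Φ = 1 := by
  induction hΦ using Subsemigroup.closure_induction with
  | mem Φ h =>
    obtain ⟨Ψ, hΨ, h1, h2⟩ := generators_exists_inverse h
    exact ⟨Ψ, Subsemigroup.subset_closure hΨ, h1, h2⟩
  | mul Φ Φ' _ _ h h' =>
    obtain ⟨Ψ, hΨ, h1, h2⟩ := h
    obtain ⟨Ψ', hΨ', h1', h2'⟩ := h'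
    refine ⟨Ψ' * Ψ, Subsemigroup.mul_mem _ hΨ' hΨ, ?_, ?_⟩
    · rw [mul_assoc, ← mul_assoc Φ', h1', one_mul, h1]
    · rw [mul_assoc, ← mul_assoc Ψ, h2, one_mul, h2']

/-- Lets results about the γ-ball pass to the dual `S(k)`-norm. -/
theorem generators_exists_transpose {Φ : Module.End ℂ (Op m n)} (hΦ : Φ ∈ generators m n k) :
    ∃ Ψ ∈ generators m n k, ∀ X Y, pairing (Φ X) Y = pairing X (Ψ Y) := by
  rcases hΦ with ⟨U, V, hU, hV, h⟩ | h | ⟨hk, h⟩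
  · refine ⟨LinearMap.mulLeft ℂ Uᵀ * LinearMap.mulRight ℂ Vᵀ,
      Or.inl ⟨Uᵀ, Vᵀ, hU.transpose, hV.transpose, fun X => by simp [mul_assoc]⟩, fun X Y => ?_⟩
    simp only [Module.End.mul_apply, LinearMap.mulLeft_apply, LinearMap.mulRight_apply, h, pairing]
    rw [transpose_mul, transpose_mul, mul_assoc, trace_mul_comm, mul_assoc, mul_assoc]
  · refine ⟨Φ, Or.inr (Or.inl h), fun X Y => ?_⟩
    rw [h, h, pairing_eq_sum, pairing_eq_sum, Finset.sum_comm]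
    rfl
  · refine ⟨Φ, Or.inr (Or.inr ⟨hk, h⟩), fun X Y => ?_⟩
    rw [h, h, pairing_eq_sum, pairing_eq_sum]
    simp only [partialTranspose, of_apply, Fintype.sum_prod_type]
    refine Finset.sum_congr rfl fun a _ => ?_
    rw [Finset.sum_comm]
    conv_rhs => rw [Finset.sum_comm]
    refine Finset.sum_congr rfl fun b _ => ?_
    rw [Finset.sum_comm]

theorem closure_exists_transpose {Φ : Module.End ℂ (Op m n)}
    (hΦ : Φ ∈ Subsemigroup.closure (generators m n k)) :
    ∃ Ψ ∈ Subsemigroup.closure (generators m n k),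
      ∀ X Y, pairing (Φ X) Y = pairing X (Ψ Y) := by
  induction hΦ using Subsemigroup.closure_induction with
  | mem Φ h =>
    obtain ⟨Ψ, hΨ, h1⟩ := generators_exists_transpose h
    exact ⟨Ψ, Subsemigroup.subset_closure hΨ, h1⟩
  | mul Φ Φ' _ _ h h' =>
    obtain ⟨Ψ, hΨ, h1⟩ := h
    obtain ⟨Ψ', hΨ', h1'⟩ := h'
    exact ⟨Ψ' * Ψ, Subsemigroup.mul_mem _ hΨ' hΨ, fun X Y => by
      rw [Module.End.mul_apply, h1, h1', Module.End.mul_apply]⟩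

end Generators

/-! ### Operators as tensors with four factors -/

section Legs

variable {m n k : ℕ}

/-- The dimensions of the four tensor factors of `M_m ⊗ M_n`. -/
def legDim (m n : ℕ) : Fin 4 → ℕ
  | 0 => m
  | 1 => n
  | 2 => m
  | 3 => n

/-- The multi-index with the given entries. -/
def legIndex (i : Fin m) (j : Fin n) (r : Fin m) (s : Fin n) : ∀ l, Fin (legDim m n l)
  | 0 => i
  | 1 => j
  | 2 => r
  | 3 => s

/-- The family of four vectors with the given members. -/
def legVecs (a : Fin m → ℂ) (b : Fin n → ℂ) (c : Fin m → ℂ) (d : Fin n → ℂ) :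
    ∀ l, Fin (legDim m n l) → ℂ
  | 0 => a
  | 1 => b
  | 2 => c
  | 3 => d

/-- The product operator `(a ⊗ b) (c ⊗ d)^T`. -/
def prodOp (a : Fin m → ℂ) (b : Fin n → ℂ) (c : Fin m → ℂ) (d : Fin n → ℂ) : Op m n :=
  vecMulVec (fun p => a p.1 * b p.2) fun p => c p.1 * d p.2

/-- Operators as tensors with four factors. -/
def toTensor (m n : ℕ) : Op m n ≃ₗ[ℂ] ((∀ l, Fin (legDim m n l)) → ℂ) where
  toFun X J := X (J 0, J 1) (J 2, J 3)
  invFun T := Matrix.of fun p q => T (legIndex p.1 p.2 q.1 q.2)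
  map_add' _ _ := rfl
  map_smul' _ _ := rfl
  left_inv _ := rfl
  right_inv T := by
    funext J
    change T (legIndex (J 0) (J 1) (J 2) (J 3)) = T J
    congr 1
    funext l
    fin_cases l <;> rfl

theorem toTensor_prodOp (a : Fin m → ℂ) (b : Fin n → ℂ) (c : Fin m → ℂ) (d : Fin n → ℂ) :
    toTensor m n (prodOp a b c d) = prodTensor (legVecs a b c d) := by
  funext J
  rw [prodTensor, Fin.prod_univ_four, mul_assoc]
  rfl

/-- The product operator with the given factors. -/
def legOp (x : ∀ l, Fin (legDim m n l) → ℂ) : Op m n := prodOp (x 0) (x 1) (x 2) (x 3)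

theorem prodTensor_eq_toTensor (x : ∀ l, Fin (legDim m n l) → ℂ) :
    prodTensor x = toTensor m n (legOp x) := by
  refine Eq.trans ?_ (toTensor_prodOp (x 0) (x 1) (x 2) (x 3)).symm
  congr 1
  funext l
  fin_cases l <;> rfl

theorem toTensor_conj_prodTensor (Φ : Module.End ℂ (Op m n)) (x : ∀ l, Fin (legDim m n l) → ℂ) :
    (toTensor m n).conj Φ (prodTensor x) = toTensor m n (Φ (legOp x)) := by
  rw [prodTensor_eq_toTensor, LinearEquiv.conj_apply_apply, LinearEquiv.symm_apply_apply]

theorem lowRankOp_prodOp (a : Fin m → ℂ) (b : Fin n → ℂ) (c : Fin m → ℂ) (d : Fin n → ℂ) :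
    LowRankOp 1 (prodOp a b c d) := ⟨_, _, lowRank_mul a b, lowRank_mul c d, rfl⟩

theorem LowRankOp.exists_prodOp {X : Op m n} (h : LowRankOp 1 X) :
    ∃ (a : Fin m → ℂ) (b : Fin n → ℂ) (c : Fin m → ℂ) (d : Fin n → ℂ), X = prodOp a b c d := by
  obtain ⟨v, w, hv, hw, rfl⟩ := h
  obtain ⟨a, b, rfl⟩ := hv.exists_mul
  obtain ⟨c, d, rfl⟩ := hw.exists_mul
  exact ⟨a, b, c, d, rfl⟩

theorem frobSq_prodOp (a : Fin m → ℂ) (b : Fin n → ℂ) (c : Fin m → ℂ) (d : Fin n → ℂ) :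
    frobSq (prodOp a b c d) = sqNorm a * sqNorm b * (sqNorm c * sqNorm d) := by
  rw [prodOp, frobSq_vecMulVec, sqNorm_mul, sqNorm_mul]

/-- `Φ` permutes the four tensor factors by `ρ` and acts linearly on each of them. -/
def ActsAs (Φ : Module.End ℂ (Op m n)) (ρ : Fin 4 → Fin 4) : Prop :=
  ActsFactorwise ((toTensor m n).conj Φ) ρ

theorem ActsAs.mul {Φ Ψ : Module.End ℂ (Op m n)} {ρ τ : Fin 4 → Fin 4} (hΦ : ActsAs Φ ρ)
    (hΨ : ActsAs Ψ τ) : ActsAs (Ψ * Φ) (ρ ∘ τ) := by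
  have := ActsFactorwise.comp hΦ hΨ
  rwa [← LinearEquiv.conj_comp] at this

theorem exists_actsAs (hm : 2 ≤ m) (hn : 2 ≤ n) (Φ : Op m n ≃ₗ[ℂ] Op m n)
    (h : ∀ X, LowRankOp 1 X → LowRankOp 1 (Φ X))
    (hsymm : ∀ X, LowRankOp 1 X → LowRankOp 1 (Φ.symm X)) :
    ∃ ρ : Equiv.Perm (Fin 4), ActsAs (Φ : Module.End ℂ (Op m n)) ρ := by
  have : ∀ l, Nontrivial (Fin (legDim m n l)) := fun l =>
    Fin.nontrivial_iff_two_le.2 (by fin_cases l <;> assumption)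
  have key : ∀ Ψ : Op m n ≃ₗ[ℂ] Op m n, (∀ X, LowRankOp 1 X → LowRankOp 1 (Ψ X)) →
      ∀ x : ∀ l, Fin (legDim m n l) → ℂ, ∃ y : ∀ l, Fin (legDim m n l) → ℂ,
        ((toTensor m n).symm ≪≫ₗ Ψ ≪≫ₗ toTensor m n) (prodTensor x) = prodTensor y := by
    intro Ψ hΨ x
    obtain ⟨a, b, c, d, e⟩ := (hΨ (legOp x) (lowRankOp_prodOp _ _ _ _)).exists_prodOp
    refine ⟨legVecs a b c d, ?_⟩
    rw [← toTensor_prodOp, ← e]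
    exact toTensor_conj_prodTensor (Ψ : Module.End ℂ (Op m n)) x
  exact exists_actsFactorwise ((toTensor m n).symm ≪≫ₗ Φ ≪≫ₗ toTensor m n) (key Φ h)
    (key Φ.symm hsymm)

/-- A permutation by which the factors are permuted respects the order of their dimensions. -/
theorem ActsAs.legDim_le {Φ : Module.End ℂ (Op m n)} {ρ : Fin 4 → Fin 4} (h : ActsAs Φ ρ)
    (j : Fin 4) : legDim m n (ρ j) ≤ legDim m n j := by
  obtain ⟨A, hA, -⟩ := h
  simpa using LinearMap.finrank_le_finrank_of_injective (hA j)

theorem ActsAs.exists_legOp {Φ : Module.End ℂ (Op m n)} {ρ : Fin 4 → Fin 4} (h : ActsAs Φ ρ) :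
    ∃ A : ∀ j, (Fin (legDim m n (ρ j)) → ℂ) →ₗ[ℂ] (Fin (legDim m n j) → ℂ),
      (∀ j, Function.Injective (A j)) ∧ ∀ x : ∀ l, Fin (legDim m n l) → ℂ, (∀ l, x l ≠ 0) →
        ∃ c : ℂ, c ≠ 0 ∧ Φ (legOp x) = c • legOp fun j => A j (x (ρ j)) := by
  obtain ⟨A, hA, h⟩ := h
  refine ⟨A, hA, fun x hx => ?_⟩
  obtain ⟨c, hc, e⟩ := h x hx
  refine ⟨c, hc, ?_⟩
  rw [toTensor_conj_prodTensor, prodTensor_eq_toTensor, ← map_smul] at e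
  exact (toTensor m n).injective e

theorem actsAs_of_legOp {Φ : Module.End ℂ (Op m n)} {ρ : Fin 4 → Fin 4}
    (A : ∀ j, (Fin (legDim m n (ρ j)) → ℂ) →ₗ[ℂ] (Fin (legDim m n j) → ℂ))
    (hA : ∀ j, Function.Injective (A j))
    (h : ∀ x : ∀ l, Fin (legDim m n l) → ℂ, Φ (legOp x) = legOp fun j => A j (x (ρ j))) :
    ActsAs Φ ρ := by
  refine ⟨A, hA, fun x _ => ⟨1, one_ne_zero, ?_⟩⟩
  rw [toTensor_conj_prodTensor, prodTensor_eq_toTensor, one_smul, h]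

/-- The identification of two factors of the same dimension. -/
def legCast (m n : ℕ) {ρ : Fin 4 → Fin 4} (hρ : ∀ j, legDim m n (ρ j) = legDim m n j) (j : Fin 4) :
    (Fin (legDim m n (ρ j)) → ℂ) →ₗ[ℂ] (Fin (legDim m n j) → ℂ) :=
  LinearMap.funLeft ℂ ℂ (Fin.cast (hρ j).symm)

theorem legCast_injective {ρ : Fin 4 → Fin 4} (hρ : ∀ j, legDim m n (ρ j) = legDim m n j)
    (j : Fin 4) : Function.Injective (legCast m n hρ j) :=
  LinearMap.funLeft_injective_of_surjective _ _ _ (finCongr (hρ j).symm).surjective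

theorem actsAs_transpose {Φ : Module.End ℂ (Op m n)} (h : ∀ X, Φ X = Xᵀ) :
    ActsAs Φ ![2, 3, 0, 1] := by
  have hρ : ∀ j, legDim m n ((![2, 3, 0, 1] : Fin 4 → Fin 4) j) = legDim m n j := by
    intro j; fin_cases j <;> rfl
  refine actsAs_of_legOp (legCast m n hρ) (legCast_injective hρ) fun x => ?_
  rw [h]
  exact transpose_vecMulVec _ _

theorem actsAs_partialTranspose {Φ : Module.End ℂ (Op m n)} (h : ∀ X, Φ X = partialTranspose X) :
    ActsAs Φ ![0, 3, 2, 1] := by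
  have hρ : ∀ j, legDim m n ((![0, 3, 2, 1] : Fin 4 → Fin 4) j) = legDim m n j := by
    intro j; fin_cases j <;> rfl
  refine actsAs_of_legOp (legCast m n hρ) (legCast_injective hρ) fun x => ?_
  rw [h]
  ext p q
  change x 0 p.1 * x 1 q.2 * (x 2 q.1 * x 3 p.2) = x 0 p.1 * x 3 p.2 * (x 2 q.1 * x 1 q.2)
  ring

theorem actsAs_swap_left {Φ : Module.End ℂ (Op n n)}
    (h : ∀ X, Φ X = (swapOp rfl : Op n n) * X) : ActsAs Φ ![1, 0, 2, 3] := by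
  have hρ : ∀ j, legDim n n ((![1, 0, 2, 3] : Fin 4 → Fin 4) j) = legDim n n j := by
    intro j; fin_cases j <;> rfl
  refine actsAs_of_legOp (legCast n n hρ) (legCast_injective hρ) fun x => ?_
  rw [h]
  ext p q
  rw [swapOp_mul_apply]
  change x 0 p.2 * x 1 p.1 * (x 2 q.1 * x 3 q.2) = x 1 p.1 * x 0 p.2 * (x 2 q.1 * x 3 q.2)
  ring

theorem actsAs_swap_right {Φ : Module.End ℂ (Op n n)}
    (h : ∀ X, Φ X = X * (swapOp rfl : Op n n)) : ActsAs Φ ![0, 1, 3, 2] := by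
  have hρ : ∀ j, legDim n n ((![0, 1, 3, 2] : Fin 4 → Fin 4) j) = legDim n n j := by
    intro j; fin_cases j <;> rfl
  refine actsAs_of_legOp (legCast n n hρ) (legCast_injective hρ) fun x => ?_
  rw [h]
  ext p q
  rw [mul_swapOp_apply]
  change x 0 p.1 * x 1 p.2 * (x 2 q.2 * x 3 q.1) = x 0 p.1 * x 1 p.2 * (x 3 q.1 * x 2 q.2)
  ring

theorem exists_eq_smul_of_prodOp (hm : 0 < m) (hn : 0 < n) (Φ : Module.End ℂ (Op m n))
    (h : ∀ (a : Fin m → ℂ) (b : Fin n → ℂ) (c : Fin m → ℂ) (d : Fin n → ℂ), a ≠ 0 → b ≠ 0 →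
      c ≠ 0 → d ≠ 0 → ∃ r : ℂ, Φ (prodOp a b c d) = r • prodOp a b c d) :
    ∃ r : ℂ, ∀ X, Φ X = r • X := by
  have : ∀ l, Nonempty (Fin (legDim m n l)) := fun l =>
    Fin.pos_iff_nonempty.1 (by fin_cases l <;> assumption)
  obtain ⟨r, hr⟩ := exists_eq_smul_of_prodTensor ((toTensor m n).conj Φ) fun x hx => by
    obtain ⟨r, hr⟩ := h (x 0) (x 1) (x 2) (x 3) (hx 0) (hx 1) (hx 2) (hx 3)
    refine ⟨r, ?_⟩
    rw [toTensor_conj_prodTensor, prodTensor_eq_toTensor, ← map_smul]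
    exact congrArg _ hr
  refine ⟨r, fun X => (toTensor m n).injective ?_⟩
  have := hr (toTensor m n X)
  rwa [LinearEquiv.conj_apply_apply, LinearEquiv.symm_apply_apply, ← map_smul] at this

end Legs

/-! ### Linear bijections that preserve the unit operators -/

section Core

variable {m n k : ℕ}

/-- Complex polarization. -/
theorem eq_zero_of_forall_dotProduct {α : Type*} [Fintype α] [DecidableEq α] {B : Matrix α α ℂ}
    (h : ∀ v, star v ⬝ᵥ (B *ᵥ v) = 0) : B = 0 := by
  have : Matrix.toEuclideanLin B = 0 := by
    refine (inner_map_self_eq_zero _).1 fun x => ?_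
    rw [← inner_conj_symm, EuclideanSpace.inner_eq_star_dotProduct]
    rw [dotProduct_comm]
    have := h x.ofLp
    simp [this]
  simpa using this

theorem exists_unitary_of_sqNorm {α : Type*} [Fintype α] [DecidableEq α] {A : Matrix α α ℂ}
    {r : ℝ} (hr : 0 < r) (h : ∀ v, sqNorm (A *ᵥ v) = r ^ 2 * sqNorm v) :
    ∃ U ∈ unitaryGroup α ℂ, A = (r : ℂ) • U := by
  have hr0 : (r : ℂ) ≠ 0 := Complex.ofReal_ne_zero.2 hr.ne'
  have hA : star A * A = ((r : ℂ) ^ 2) • 1 := by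
    rw [← sub_eq_zero]
    refine eq_zero_of_forall_dotProduct fun v => ?_
    have := congrArg (fun t : ℝ => (t : ℂ)) (h v)
    simp only [Complex.ofReal_mul, Complex.ofReal_pow, ofReal_sqNorm, star_mulVec,
      ← dotProduct_mulVec, mulVec_mulVec] at this
    rw [sub_mulVec, dotProduct_sub, star_eq_conjTranspose, this]
    simp [smul_mulVec]
  refine ⟨(r : ℂ)⁻¹ • A, ?_, by rw [smul_smul, mul_inv_cancel₀ hr0, one_smul]⟩
  rw [mem_unitaryGroup_iff', star_smul, smul_mul_smul_comm, hA, smul_smul]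
  have : star (r : ℂ)⁻¹ * (r : ℂ)⁻¹ * (r : ℂ) ^ 2 = 1 := by
    rw [star_inv₀]
    have : star (r : ℂ) = r := Complex.conj_ofReal r
    rw [this]; field_simp
  rw [this, one_smul]

/-- The map `X ↦ (A ⊗ B) X (C ⊗ D)^T`. -/
def localMap (A : Matrix (Fin m) (Fin m) ℂ) (B : Matrix (Fin n) (Fin n) ℂ)
    (C : Matrix (Fin m) (Fin m) ℂ) (D : Matrix (Fin n) (Fin n) ℂ) : Module.End ℂ (Op m n) :=
  LinearMap.mulLeft ℂ (A ⊗ₖ B) * LinearMap.mulRight ℂ (C ⊗ₖ D)ᵀ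

theorem localMap_apply (A : Matrix (Fin m) (Fin m) ℂ) (B : Matrix (Fin n) (Fin n) ℂ)
    (C : Matrix (Fin m) (Fin m) ℂ) (D : Matrix (Fin n) (Fin n) ℂ) (X : Op m n) :
    localMap A B C D X = (A ⊗ₖ B) * X * (C ⊗ₖ D)ᵀ := by
  simp [localMap, Matrix.mul_assoc]

theorem kronecker_mulVec_mul (A : Matrix (Fin m) (Fin m) ℂ) (B : Matrix (Fin n) (Fin n) ℂ)
    (a : Fin m → ℂ) (b : Fin n → ℂ) : (A ⊗ₖ B) *ᵥ (fun p => a p.1 * b p.2) =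
      fun p => (A *ᵥ a) p.1 * (B *ᵥ b) p.2 := by
  funext p
  simp only [mulVec, dotProduct, kroneckerMap_apply, Fintype.sum_prod_type, Finset.sum_mul_sum]
  exact Finset.sum_congr rfl fun _ _ => Finset.sum_congr rfl fun _ _ => by ring

theorem localMap_prodOp (A : Matrix (Fin m) (Fin m) ℂ) (B : Matrix (Fin n) (Fin n) ℂ)
    (C : Matrix (Fin m) (Fin m) ℂ) (D : Matrix (Fin n) (Fin n) ℂ)
    (a : Fin m → ℂ) (b : Fin n → ℂ) (c : Fin m → ℂ) (d : Fin n → ℂ) :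
    localMap A B C D (prodOp a b c d) = prodOp (A *ᵥ a) (B *ᵥ b) (C *ᵥ c) (D *ᵥ d) := by
  rw [localMap_apply, prodOp, mul_vecMulVec, vecMulVec_mul, vecMul_transpose,
    kronecker_mulVec_mul, kronecker_mulVec_mul]
  rfl

/-- A map that preserves each of the four factors is a scalar multiple of a local map. -/
theorem ActsAs.exists_localMap (hm : 0 < m) (hn : 0 < n) {Φ : Module.End ℂ (Op m n)}
    (h : ActsAs Φ id) : ∃ A B C D, ∀ X, Φ X = localMap A B C D X := by
  obtain ⟨L, hL, h⟩ := h.exists_legOp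
  let A : Matrix (Fin m) (Fin m) ℂ :=
    LinearMap.toMatrix' (show (Fin m → ℂ) →ₗ[ℂ] (Fin m → ℂ) from L 0)
  let B : Matrix (Fin n) (Fin n) ℂ :=
    LinearMap.toMatrix' (show (Fin n → ℂ) →ₗ[ℂ] (Fin n → ℂ) from L 1)
  let C : Matrix (Fin m) (Fin m) ℂ :=
    LinearMap.toMatrix' (show (Fin m → ℂ) →ₗ[ℂ] (Fin m → ℂ) from L 2)
  let D : Matrix (Fin n) (Fin n) ℂ :=
    LinearMap.toMatrix' (show (Fin n → ℂ) →ₗ[ℂ] (Fin n → ℂ) from L 3)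
  have unit : ∀ {r : ℕ} (f : (Fin r → ℂ) →ₗ[ℂ] (Fin r → ℂ)), Function.Injective f →
      IsUnit (LinearMap.toMatrix' f).det := by
    intro r f hf
    rw [← isUnit_iff_isUnit_det, ← mulVec_injective_iff_isUnit]
    intro v w hvw
    simp only [LinearMap.toMatrix'_mulVec] at hvw
    exact hf hvw
  have hA : IsUnit A.det := unit _ (hL 0)
  have hB : IsUnit B.det := unit _ (hL 1)
  have hC : IsUnit C.det := unit _ (hL 2)
  have hD : IsUnit D.det := unit _ (hL 3)
  have hprod : ∀ (a : Fin m → ℂ) (b : Fin n → ℂ) (c : Fin m → ℂ) (d : Fin n → ℂ), a ≠ 0 → b ≠ 0 →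
      c ≠ 0 → d ≠ 0 → ∃ r : ℂ,
        Φ (prodOp a b c d) = r • prodOp (A *ᵥ a) (B *ᵥ b) (C *ᵥ c) (D *ᵥ d) := by
    intro a b c d ha hb hc hd
    obtain ⟨r, -, e⟩ := h (legVecs a b c d) (by
      intro l; fin_cases l <;> assumption)
    refine ⟨r, ?_⟩
    have e0 : ∀ v, A *ᵥ v = L 0 v := fun v => LinearMap.toMatrix'_mulVec _ v
    have e1 : ∀ v, B *ᵥ v = L 1 v := fun v => LinearMap.toMatrix'_mulVec _ v
    have e2 : ∀ v, C *ᵥ v = L 2 v := fun v => LinearMap.toMatrix'_mulVec _ v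
    have e3 : ∀ v, D *ᵥ v = L 3 v := fun v => LinearMap.toMatrix'_mulVec _ v
    rw [e0, e1, e2, e3]
    exact e
  -- The scalar in `hprod` may depend on the product operator. After undoing the local map every
  -- product operator is an eigenvector, so the scalar is constant; it is then absorbed into `A`.
  obtain ⟨r, hr⟩ := exists_eq_smul_of_prodOp hm hn (localMap A⁻¹ B⁻¹ C⁻¹ D⁻¹ * Φ)
    fun a b c d ha hb hc hd => by
      obtain ⟨r, hr⟩ := hprod a b c d ha hb hc hd
      refine ⟨r, ?_⟩
      rw [Module.End.mul_apply, hr, map_smul, localMap_prodOp]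
      simp only [mulVec_mulVec, nonsing_inv_mul _ hA, nonsing_inv_mul _ hB, nonsing_inv_mul _ hC,
        nonsing_inv_mul _ hD, one_mulVec]
  refine ⟨r • A, B, C, D, fun X => ?_⟩
  have e := congrArg (localMap A B C D) (hr X)
  rw [Module.End.mul_apply, localMap_apply, localMap_apply, map_smul] at e
  have e1 : (A ⊗ₖ B) * (A⁻¹ ⊗ₖ B⁻¹) = (1 : Op m n) := by
    rw [← mul_kronecker_mul, mul_nonsing_inv _ hA, mul_nonsing_inv _ hB, one_kronecker_one]
  have e2 : (C⁻¹ ⊗ₖ D⁻¹)ᵀ * (C ⊗ₖ D)ᵀ = (1 : Op m n) := by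
    rw [← transpose_mul, ← mul_kronecker_mul, mul_nonsing_inv _ hC, mul_nonsing_inv _ hD,
      one_kronecker_one, transpose_one]
  rw [Matrix.mul_assoc, Matrix.mul_assoc _ _ (C ⊗ₖ D)ᵀ, e2, Matrix.mul_one, ← Matrix.mul_assoc, e1,
    Matrix.one_mul] at e
  rw [e, localMap_apply, localMap_apply, smul_kronecker, Matrix.smul_mul, Matrix.smul_mul]

/-- A map that preserves each of the four factors and the unit product operators is a local
unitary. -/
theorem ActsAs.mem_generators (hk : 1 ≤ k) (hm : 0 < m) (hn : 0 < n) {Φ : Module.End ℂ (Op m n)}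
    (h : ActsAs Φ id) (hΦ : ∀ X ∈ unitOps m n k, Φ X ∈ unitOps m n k) :
    Φ ∈ generators m n k := by
  obtain ⟨A, B, C, D, h⟩ := h.exists_localMap hm hn
  have hnorm : ∀ a b c d, sqNorm (A *ᵥ a) * sqNorm (B *ᵥ b) *
      (sqNorm (C *ᵥ c) * sqNorm (D *ᵥ d)) = sqNorm a * sqNorm b * (sqNorm c * sqNorm d) := by
    intro a b c d
    have := ((lowRankOp_prodOp a b c d).mono hk).frobSq_map hΦ
    rwa [h, localMap_prodOp, frobSq_prodOp, frobSq_prodOp] at this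
  let e : Fin m → ℂ := Pi.single ⟨0, hm⟩ 1
  let f : Fin n → ℂ := Pi.single ⟨0, hn⟩ 1
  have he : sqNorm e = 1 := sqNorm_single _
  have hf : sqNorm f = 1 := sqNorm_single _
  have h0 := hnorm e f e f
  rw [he, hf] at h0
  have hA0 : 0 < sqNorm (A *ᵥ e) := lt_of_le_of_ne (sqNorm_nonneg _) fun h => by
    rw [← h] at h0; norm_num at h0
  have hB0 : 0 < sqNorm (B *ᵥ f) := lt_of_le_of_ne (sqNorm_nonneg _) fun h => by
    rw [← h] at h0; norm_num at h0
  have hC0 : 0 < sqNorm (C *ᵥ e) := lt_of_le_of_ne (sqNorm_nonneg _) fun h => by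
    rw [← h] at h0; norm_num at h0
  have hD0 : 0 < sqNorm (D *ᵥ f) := lt_of_le_of_ne (sqNorm_nonneg _) fun h => by
    rw [← h] at h0; norm_num at h0
  -- Freezing the other three factors at unit vectors shows that each matrix scales all norms by a
  -- constant.
  have hA : ∀ v, sqNorm (A *ᵥ v) = Real.sqrt (sqNorm (A *ᵥ e)) ^ 2 * sqNorm v := by
    intro v
    have := hnorm v f e f
    rw [he, hf] at this
    rw [Real.sq_sqrt hA0.le]
    linear_combination sqNorm (A *ᵥ e) * this - sqNorm (A *ᵥ v) * h0
  have hB : ∀ v, sqNorm (B *ᵥ v) = Real.sqrt (sqNorm (B *ᵥ f)) ^ 2 * sqNorm v := by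
    intro v
    have := hnorm e v e f
    rw [he, hf] at this
    rw [Real.sq_sqrt hB0.le]
    linear_combination sqNorm (B *ᵥ f) * this - sqNorm (B *ᵥ v) * h0
  have hC : ∀ v, sqNorm (C *ᵥ v) = Real.sqrt (sqNorm (C *ᵥ e)) ^ 2 * sqNorm v := by
    intro v
    have := hnorm e f v f
    rw [he, hf] at this
    rw [Real.sq_sqrt hC0.le]
    linear_combination sqNorm (C *ᵥ e) * this - sqNorm (C *ᵥ v) * h0
  have hD : ∀ v, sqNorm (D *ᵥ v) = Real.sqrt (sqNorm (D *ᵥ f)) ^ 2 * sqNorm v := by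
    intro v
    have := hnorm e f e v
    rw [he, hf] at this
    rw [Real.sq_sqrt hD0.le]
    linear_combination sqNorm (D *ᵥ f) * this - sqNorm (D *ᵥ v) * h0
  obtain ⟨U₁, hU₁, eA⟩ := exists_unitary_of_sqNorm (Real.sqrt_pos.2 hA0) hA
  obtain ⟨U₂, hU₂, eB⟩ := exists_unitary_of_sqNorm (Real.sqrt_pos.2 hB0) hB
  obtain ⟨U₃, hU₃, eC⟩ := exists_unitary_of_sqNorm (Real.sqrt_pos.2 hC0) hC
  obtain ⟨U₄, hU₄, eD⟩ := exists_unitary_of_sqNorm (Real.sqrt_pos.2 hD0) hD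
  have hone : Real.sqrt (sqNorm (A *ᵥ e)) * Real.sqrt (sqNorm (B *ᵥ f)) *
      (Real.sqrt (sqNorm (C *ᵥ e)) * Real.sqrt (sqNorm (D *ᵥ f))) = 1 := by
    rw [← Real.sqrt_mul hA0.le, ← Real.sqrt_mul hC0.le, ← Real.sqrt_mul (by positivity), h0]
    norm_num
  refine Or.inl ⟨U₁ ⊗ₖ U₂, (U₃ ⊗ₖ U₄)ᵀ, ⟨U₁, hU₁, U₂, hU₂, Or.inl rfl⟩,
    IsLocalUnitary.transpose ⟨U₃, hU₃, U₄, hU₄, Or.inl rfl⟩, fun X => ?_⟩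
  rw [h, localMap_apply, eA, eB, eC, eD]
  simp only [smul_kronecker, kronecker_smul, smul_smul, transpose_smul, Matrix.smul_mul,
    Matrix.mul_smul]
  have hone' := congrArg (fun t : ℝ => (t : ℂ)) hone
  simp only [Complex.ofReal_mul, Complex.ofReal_one] at hone'
  have : ∀ s : ℂ, s = 1 → s • (U₁ ⊗ₖ U₂ * X * (U₃ ⊗ₖ U₄)ᵀ) = U₁ ⊗ₖ U₂ * X * (U₃ ⊗ₖ U₄)ᵀ := by
    intro s hs; rw [hs, one_smul]
  apply this
  linear_combination hone'

/-- For `k ≥ 2`, the action of a map that preserves the operators `v w^T` with `v`, `w` of rank at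
most `k` is not that of the partial transpose. -/
theorem not_actsAs_partialTranspose (hk : 2 ≤ k) (hm : 2 ≤ m) (hn : 2 ≤ n)
    {Φ : Module.End ℂ (Op m n)} (hΦ : ∀ X, LowRankOp k X → LowRankOp k (Φ X)) :
    ¬ ActsAs Φ ![0, 3, 2, 1] := by
  intro h
  obtain ⟨L, hL, h⟩ := h.exists_legOp
  let A : (Fin m → ℂ) →ₗ[ℂ] (Fin m → ℂ) := L 0
  let B : (Fin n → ℂ) →ₗ[ℂ] (Fin n → ℂ) := L 1
  let C : (Fin m → ℂ) →ₗ[ℂ] (Fin m → ℂ) := L 2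
  let D : (Fin n → ℂ) →ₗ[ℂ] (Fin n → ℂ) := L 3
  have hA : Function.Injective A := hL 0
  have hB : Function.Injective B := hL 1
  have hC : Function.Injective C := hL 2
  have hD : Function.Injective D := hL 3
  have hprod : ∀ (a : Fin m → ℂ) (b : Fin n → ℂ) (c : Fin m → ℂ) (d : Fin n → ℂ), a ≠ 0 → b ≠ 0 →
      c ≠ 0 → d ≠ 0 → ∃ r : ℂ, r ≠ 0 ∧
        Φ (prodOp a b c d) = r • prodOp (A a) (B d) (C c) (D b) := by
    intro a b c d ha hb hc hd
    exact h (legVecs a b c d) (by intro l; fin_cases l <;> assumption)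
  let e₀ : Fin m → ℂ := Pi.single ⟨0, by omega⟩ 1
  let e₁ : Fin m → ℂ := Pi.single ⟨1, by omega⟩ 1
  let f₀ : Fin n → ℂ := Pi.single ⟨0, by omega⟩ 1
  let f₁ : Fin n → ℂ := Pi.single ⟨1, by omega⟩ 1
  have he₀ : e₀ ≠ 0 := by simp [e₀]
  have he₁ : e₁ ≠ 0 := by simp [e₁]
  have hf₀ : f₀ ≠ 0 := by simp [f₀]
  have hf₁ : f₁ ≠ 0 := by simp [f₁]
  have hee : ∀ c : ℂ, e₁ ≠ c • e₀ := fun c hc => by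
    have := congrFun hc ⟨1, by omega⟩
    simp [e₀, e₁] at this
  have hff : ∀ c c' : ℂ, c • f₀ = c' • f₁ → c = 0 := fun c c' hc => by
    have := congrFun hc ⟨0, by omega⟩
    simpa [f₀, f₁] using this
  obtain ⟨r, hr, er⟩ := hprod e₀ f₀ e₀ f₀ he₀ hf₀ he₀ hf₀
  obtain ⟨s, hs, es⟩ := hprod e₁ f₁ e₀ f₀ he₁ hf₁ he₀ hf₀
  -- The operator `(e₀ ⊗ f₀ + e₁ ⊗ f₁)(e₀ ⊗ f₀)^T` is in the cone because `k ≥ 2`. Exchanging the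
  -- second and fourth factors turns it into a sum with independent left factors and independent
  -- right factors, which has operator rank two.
  have hlow : LowRankOp k (prodOp e₀ f₀ e₀ f₀ + prodOp e₁ f₁ e₀ f₀) := by
    refine ⟨fun p => ∑ l : Fin 2, (![e₀, e₁] l) p.1 * (![f₀, f₁] l) p.2,
      fun p => e₀ p.1 * f₀ p.2, ?_, (lowRank_mul _ _).mono (by omega), ?_⟩
    · exact (lowRank_sum ![e₀, e₁] ![f₀, f₁]).mono (by simpa using hk)
    · ext p q
      simp [prodOp, vecMulVec_apply, Fin.sum_univ_two]
      ring
  have himg := hΦ _ hlow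
  rw [map_add, er, es] at himg
  obtain ⟨v, w, -, -, e⟩ := himg
  have hBf : B f₀ ≠ 0 := fun h0 => hf₀ ((injective_iff_map_eq_zero B).1 hB _ h0)
  have hCe : C e₀ ≠ 0 := fun h0 => he₀ ((injective_iff_map_eq_zero C).1 hC _ h0)
  obtain ⟨j, hj⟩ := Function.ne_iff.1 hBf
  obtain ⟨i, hi⟩ := Function.ne_iff.1 hCe
  simp only [Pi.zero_apply] at hi hj
  have hdet : ∃ s t, A e₀ s * A e₁ t - A e₀ t * A e₁ s ≠ 0 := by
    by_contra hno
    push Not at hno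
    obtain ⟨c, hc⟩ := exists_smul_of_minors
      (fun h0 => he₀ ((injective_iff_map_eq_zero A).1 hA _ h0)) hno
    rw [← map_smul] at hc
    exact hee c (hA hc)
  obtain ⟨x, y, hdet⟩ := hdet
  -- Fixing entry `j` of the second factor and `i` of the third leaves a combination of `A e₀ (D
  -- f₀)^T` and `A e₁ (D f₁)^T` of rank at most one, so `D f₀` and `D f₁` would be proportional.
  obtain ⟨⟨c, hc⟩, c', hc'⟩ := exists_smul_of_add_eq_mul (p := A e₀) (p' := A e₁)
    (q := (r * B f₀ j * C e₀ i) • D f₀) (q' := (s * B f₀ j * C e₀ i) • D f₁)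
    (v := fun t => v (t, j)) (w := fun t => w (i, t)) hdet (fun t u => by
      have := congrFun (congrFun e (t, j)) (i, u)
      simp only [prodOp, Matrix.add_apply, Matrix.smul_apply, vecMulVec_apply, smul_eq_mul] at this
      simp only [Pi.smul_apply, smul_eq_mul]
      linear_combination this)
  have hkey : (c' * (r * B f₀ j * C e₀ i)) • f₀ = (c * (s * B f₀ j * C e₀ i)) • f₁ := by
    apply hD
    rw [map_smul, map_smul, mul_smul c', mul_smul c, hc, hc', smul_comm]
  have h0 := hff _ _ hkey
  have hrBC : r * B f₀ j * C e₀ i ≠ 0 := mul_ne_zero (mul_ne_zero hr hj) hi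
  have hsBC : s * B f₀ j * C e₀ i ≠ 0 := mul_ne_zero (mul_ne_zero hs hj) hi
  have hc0 : c' = 0 := (mul_eq_zero.1 h0).resolve_right hrBC
  rw [hc0, zero_smul] at hc'
  have := (smul_eq_zero.1 hc').resolve_left hsBC
  exact hf₁ ((injective_iff_map_eq_zero D).1 hD _ this)

/-- A permutation of the factors is realized by a composition of generators. -/
def IsRealized (m n k : ℕ) (τ : Fin 4 → Fin 4) : Prop :=
  ∃ G ∈ Subsemigroup.closure (generators m n k), ActsAs G τ

theorem IsRealized.comp {τ τ' : Fin 4 → Fin 4} (h : IsRealized m n k τ)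
    (h' : IsRealized m n k τ') : IsRealized m n k (τ ∘ τ') := by
  obtain ⟨G, hG, h⟩ := h
  obtain ⟨G', hG', h'⟩ := h'
  exact ⟨G' * G, Subsemigroup.mul_mem _ hG' hG, h.mul h'⟩

theorem isRealized_id : IsRealized m n k id := by
  refine ⟨1, Subsemigroup.subset_closure
    (Or.inl ⟨1, 1, isLocalUnitary_one, isLocalUnitary_one, fun X => by simp⟩), ?_⟩
  exact actsAs_of_legOp (fun j => LinearMap.id) (fun j => Function.injective_id) fun x => rfl

theorem IsRealized.cond {τ : Fin 4 → Fin 4} (h : IsRealized m n k τ) (x : Bool) :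
    IsRealized m n k (cond x τ id) := by
  cases x
  exacts [isRealized_id, h]

theorem isRealized_transpose : IsRealized m n k ![2, 3, 0, 1] := by
  let G : Module.End ℂ (Op m n) := (transposeLinearEquiv _ _ ℂ ℂ).toLinearMap
  exact ⟨G, Subsemigroup.subset_closure (Or.inr (Or.inl fun X => rfl)),
    actsAs_transpose fun X => rfl⟩

theorem isRealized_swap_left : IsRealized n n k ![1, 0, 2, 3] :=
  ⟨LinearMap.mulLeft ℂ (swapOp rfl), Subsemigroup.subset_closure
    (Or.inl ⟨swapOp rfl, 1, isLocalUnitary_swapOp, isLocalUnitary_one, fun X => by simp⟩),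
    actsAs_swap_left fun X => rfl⟩

theorem isRealized_swap_right : IsRealized n n k ![0, 1, 3, 2] :=
  ⟨LinearMap.mulRight ℂ (swapOp rfl), Subsemigroup.subset_closure
    (Or.inl ⟨1, swapOp rfl, isLocalUnitary_one, isLocalUnitary_swapOp, fun X => by simp⟩),
    actsAs_swap_right fun X => rfl⟩

set_option synthInstance.maxHeartbeats 200000 in
set_option synthInstance.maxSize 1000 in
/-- Up to swaps within the pairs of factors and the exchange of the pairs, a permutation of four
factors is trivial or a partial transpose. -/
theorem exists_comp_eq (a b c d : Fin 4) (hab : a ≠ b) (hac : a ≠ c) (had : a ≠ d) (hbc : b ≠ c)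
    (hbd : b ≠ d) (hcd : c ≠ d) :
    ∃ x y z w : Bool,
      ((cond x ![1, 0, 2, 3] id ∘ cond y ![0, 1, 3, 2] id) ∘ cond z ![2, 3, 0, 1] id) ∘
          ![a, b, c, d] ∘ cond w ![1, 0, 2, 3] id = id ∨
      ((cond x ![1, 0, 2, 3] id ∘ cond y ![0, 1, 3, 2] id) ∘ cond z ![2, 3, 0, 1] id) ∘
          ![a, b, c, d] ∘ cond w ![1, 0, 2, 3] id = ![0, 3, 2, 1] := by
  revert a b c d
  decide

-- The version for factors of different dimensions: only the transpose is available, but the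
-- permutation preserves the pairs `{0, 2}` and `{1, 3}`.
set_option synthInstance.maxHeartbeats 200000 in
set_option synthInstance.maxSize 1000 in
theorem exists_transpose_comp_eq (a b c d : Fin 4) (hab : a ≠ b) (hac : a ≠ c) (had : a ≠ d)
    (hbc : b ≠ c) (hbd : b ≠ d) (hcd : c ≠ d)
    (h : ((a = 0 ∨ a = 2) ∧ (c = 0 ∨ c = 2)) ∨ ((b = 1 ∨ b = 3) ∧ (d = 1 ∨ d = 3))) :
    ∃ z : Bool, cond z ![2, 3, 0, 1] id ∘ ![a, b, c, d] = id ∨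
      cond z ![2, 3, 0, 1] id ∘ ![a, b, c, d] = ![0, 3, 2, 1] := by
  revert a b c d
  decide

theorem exists_isRealized {Φ : Module.End ℂ (Op m n)} (ρ : Equiv.Perm (Fin 4))
    (hρ : ActsAs Φ ρ) : ∃ τ τ', IsRealized m n k τ ∧ IsRealized m n k τ' ∧
      (τ ∘ ρ ∘ τ' = id ∨ τ ∘ ρ ∘ τ' = ![0, 3, 2, 1]) := by
  have hvec : (ρ : Fin 4 → Fin 4) = ![ρ 0, ρ 1, ρ 2, ρ 3] := by
    funext j; fin_cases j <;> rfl
  have hne : ∀ i j : Fin 4, i ≠ j → ρ i ≠ ρ j := fun i j => ρ.injective.ne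
  rw [hvec]
  by_cases hmn : m = n
  · subst hmn
    obtain ⟨x, y, z, w, h⟩ := exists_comp_eq (ρ 0) (ρ 1) (ρ 2) (ρ 3)
      (hne _ _ (by decide)) (hne _ _ (by decide)) (hne _ _ (by decide)) (hne _ _ (by decide))
      (hne _ _ (by decide)) (hne _ _ (by decide))
    exact ⟨_, _, ((isRealized_swap_left.cond x).comp (isRealized_swap_right.cond y)).comp
      (isRealized_transpose.cond z), isRealized_swap_left.cond w, h⟩
  · have hle := hρ.legDim_le
    -- Injectivity of the factor maps bounds dimensions in one direction, which pins down the pair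
    -- of smaller dimension; the other pair follows by bijectivity.
    have hdim : ((ρ 0 = 0 ∨ ρ 0 = 2) ∧ (ρ 2 = 0 ∨ ρ 2 = 2)) ∨
        ((ρ 1 = 1 ∨ ρ 1 = 3) ∧ (ρ 3 = 1 ∨ ρ 3 = 3)) := by
      rcases lt_or_gt_of_ne hmn with hlt | hlt
      · left
        have key : ∀ j : Fin 4, legDim m n j ≤ m → j = 0 ∨ j = 2 := by
          intro j hj
          fin_cases j
          · exact Or.inl rfl
          · exact absurd hj (not_le.2 hlt)
          · exact Or.inr rfl
          · exact absurd hj (not_le.2 hlt)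
        exact ⟨key _ (hle 0), key _ (hle 2)⟩
      · right
        have key : ∀ j : Fin 4, legDim m n j ≤ n → j = 1 ∨ j = 3 := by
          intro j hj
          fin_cases j
          · exact absurd hj (not_le.2 hlt)
          · exact Or.inl rfl
          · exact absurd hj (not_le.2 hlt)
          · exact Or.inr rfl
        exact ⟨key _ (hle 1), key _ (hle 3)⟩
    obtain ⟨z, h⟩ := exists_transpose_comp_eq (ρ 0) (ρ 1) (ρ 2) (ρ 3)
      (hne _ _ (by decide)) (hne _ _ (by decide)) (hne _ _ (by decide)) (hne _ _ (by decide))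
      (hne _ _ (by decide)) (hne _ _ (by decide)) hdim
    exact ⟨_, id, isRealized_transpose.cond z, isRealized_id, h⟩

/-- A linear bijection that, with its inverse, preserves the operators `v w^T` with unit vectors
`v`, `w` of Schmidt rank at most `k` is a composition of generators. -/
theorem mem_closure_of_unitOps (hk : 1 ≤ k) (hm : k < m) (hn : k < n) (Φ : Op m n ≃ₗ[ℂ] Op m n)
    (h : ∀ X ∈ unitOps m n k, Φ X ∈ unitOps m n k)
    (h' : ∀ X ∈ unitOps m n k, Φ.symm X ∈ unitOps m n k) :
    (Φ : Module.End ℂ (Op m n)) ∈ Subsemigroup.closure (generators m n k) := by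
  have hlow : ∀ X, LowRankOp k X → LowRankOp k (Φ X) := fun X hX =>
    hX.map (Φ := (Φ : Module.End ℂ (Op m n))) h
  have hlow' : ∀ X, LowRankOp k X → LowRankOp k (Φ.symm X) := fun X hX =>
    hX.map (Φ := (Φ.symm : Module.End ℂ (Op m n))) h'
  obtain ⟨ρ, hρ⟩ := exists_actsAs (by omega) (by omega) Φ
    (fun X hX => LowRankOp.map_one hk hm hn Φ hlow hlow' hX)
    (fun X hX => LowRankOp.map_one hk hm hn Φ.symm hlow' hlow hX)
  obtain ⟨τ, τ', ⟨G, hG, hGτ⟩, ⟨G', hG', hGτ'⟩, hor⟩ := exists_isRealized (k := k) ρ hρ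
  have hacts : ActsAs (G' * (Φ : Module.End ℂ (Op m n)) * G) (τ ∘ ρ ∘ τ') := hGτ.mul (hρ.mul hGτ')
  have hK : ∀ X ∈ unitOps m n k, (G' * (Φ : Module.End ℂ (Op m n)) * G) X ∈ unitOps m n k :=
    fun X hX => closure_mem_unitOps hG' _ (h _ (closure_mem_unitOps hG _ hX))
  have hmem : G' * (Φ : Module.End ℂ (Op m n)) * G ∈ Subsemigroup.closure (generators m n k) := by
    rcases hor with e | e
    · rw [e] at hacts
      exact Subsemigroup.subset_closure (hacts.mem_generators hk (by omega) (by omega) hK)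
    · rw [e] at hacts
      rcases Nat.lt_or_ge 1 k with hk2 | hk1
      · exact absurd hacts (not_actsAs_partialTranspose hk2 (by omega) (by omega)
          fun X hX => hX.map hK)
      · have hk1 : k = 1 := le_antisymm hk1 hk
        let P : Module.End ℂ (Op m n) :=
          { toFun := partialTranspose
            map_add' := fun _ _ => rfl
            map_smul' := fun _ _ => rfl }
        have hP : P ∈ Subsemigroup.closure (generators m n k) :=
          Subsemigroup.subset_closure (Or.inr (Or.inr ⟨hk1, fun X => rfl⟩))
        have hPP : P * P = 1 := LinearMap.ext fun X => partialTranspose_partialTranspose X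
        -- For `k = 1` the partial transpose is itself a generator and an involution, so it can be
        -- composed away.
        have hact : ActsAs (P * (G' * (Φ : Module.End ℂ (Op m n)) * G)) id := by
          have := hacts.mul (actsAs_partialTranspose (Φ := P) fun X => rfl)
          have e : (![0, 3, 2, 1] : Fin 4 → Fin 4) ∘ ![0, 3, 2, 1] = id := by decide
          rwa [e] at this
        have hgen := hact.mem_generators hk (by omega) (by omega)
          fun X hX => closure_mem_unitOps hP _ (hK X hX)
        have := Subsemigroup.mul_mem _ hP (Subsemigroup.subset_closure hgen)
        rwa [← mul_assoc P P, hPP, one_mul] at this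
  obtain ⟨H, hH, -, hHG⟩ := closure_exists_inverse hG'
  obtain ⟨F, hF, hGF, -⟩ := closure_exists_inverse hG
  have := Subsemigroup.mul_mem _ (Subsemigroup.mul_mem _ hH hmem) hF
  rwa [mul_assoc, mul_assoc, hGF, mul_one, ← mul_assoc, hHG, one_mul] at this

end Core

/-! ### The convex hull of the unit operators and its extreme points -/

section ConvexHull

/-- In finite dimensions the convex hull of a compact set is compact. -/
theorem isCompact_convexHull {E : Type*} [AddCommGroup E] [Module ℝ E] [TopologicalSpace E]
    [IsTopologicalAddGroup E] [ContinuousSMul ℝ E] [FiniteDimensional ℝ E] {s : Set E}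
    (hs : IsCompact s) : IsCompact (convexHull ℝ s) := by
  rcases s.eq_empty_or_nonempty with rfl | ⟨y, hy⟩
  · simp
  -- Carathéodory's bound: `N` points suffice, so the hull is a continuous image of a simplex times
  -- `s^N`. Shorter combinations are padded with weight zero at `y`.
  let N := Module.finrank ℝ E + 1
  have himg : convexHull ℝ s = (fun q : (Fin N → ℝ) × (Fin N → E) => ∑ i, q.1 i • q.2 i) ''
      (stdSimplex ℝ (Fin N) ×ˢ Set.pi Set.univ fun _ => s) := by
    ext x
    constructor
    · intro hx
      obtain ⟨ι, _, z, w, hz, hai, hw, hw1, rfl⟩ := eq_pos_convex_span_of_mem_convexHull hx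
      have hcard : Fintype.card ι ≤ N :=
        hai.card_le_finrank_succ.trans (Nat.succ_le_succ (Submodule.finrank_le _))
      obtain ⟨f⟩ : Nonempty (ι ↪ Fin N) :=
        Function.Embedding.nonempty_of_card_le (by simpa using hcard)
      have hext : ∀ i ∉ Set.range f, Function.extend f w 0 i = 0 := fun i hi =>
        Function.extend_apply' _ _ _ hi
      refine ⟨(Function.extend f w 0, Function.extend f z fun _ => y),
        ⟨⟨fun i => ?_, ?_⟩, fun i _ => ?_⟩, ?_⟩
      · by_cases hi : i ∈ Set.range f
        · obtain ⟨j, rfl⟩ := hi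
          simpa [f.injective.extend_apply] using (hw j).le
        · exact (hext i hi).ge
      · rw [← hw1]
        exact (Fintype.sum_of_injective f f.injective _ _ hext fun i => by
          simp [f.injective.extend_apply]).symm
      · by_cases hi : i ∈ Set.range f
        · obtain ⟨j, rfl⟩ := hi
          simpa [f.injective.extend_apply] using hz ⟨j, rfl⟩
        · change Function.extend f z (fun _ => y) i ∈ s
          rwa [Function.extend_apply' _ _ _ hi]
      · exact (Fintype.sum_of_injective f f.injective _ _
          (fun i hi => by simp only [hext i hi, zero_smul]) fun i => by
          simp [f.injective.extend_apply]).symm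
    · rintro ⟨⟨w, z⟩, ⟨hw, hz⟩, rfl⟩
      exact mem_convexHull_of_exists_fintype w z hw.1 hw.2 (fun i => hz i trivial) rfl
  rw [himg]
  refine ((isCompact_stdSimplex ℝ (Fin N)).prod (isCompact_univ_pi fun _ => hs)).image ?_
  fun_prop

variable {m n k : ℕ}

theorem isCompact_unitVecs : IsCompact {v : Fin m × Fin n → ℂ | sqNorm v = 1 ∧ LowRank k v} := by
  refine (isCompact_univ_pi fun _ : Fin m × Fin n =>
    isCompact_closedBall (0 : ℂ) 1).of_isClosed_subset ?_ ?_
  · refine (isClosed_eq ?_ continuous_const).inter isClosed_lowRank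
    unfold sqNorm
    fun_prop
  · rintro v ⟨hv, -⟩ p -
    rw [mem_closedBall_zero_iff]
    have : ‖v p‖ ^ 2 ≤ 1 := by
      rw [← hv]
      exact Finset.single_le_sum (f := fun q => ‖v q‖ ^ 2) (fun q _ => sq_nonneg _)
        (Finset.mem_univ p)
    have := norm_nonneg (v p)
    nlinarith

theorem isCompact_unitOps : IsCompact (unitOps m n k) := by
  have : unitOps m n k = (fun q : (Fin m × Fin n → ℂ) × (Fin m × Fin n → ℂ) =>
      vecMulVec q.1 q.2) '' ({v | sqNorm v = 1 ∧ LowRank k v} ×ˢ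
        {v | sqNorm v = 1 ∧ LowRank k v}) := by
    ext X
    constructor
    · rintro ⟨v, w, hv, hw, hkv, hkw, rfl⟩
      exact ⟨(v, w), ⟨⟨hv, hkv⟩, hw, hkw⟩, rfl⟩
    · rintro ⟨⟨v, w⟩, ⟨⟨hv, hkv⟩, hw, hkw⟩, rfl⟩
      exact ⟨v, w, hv, hw, hkv, hkw, rfl⟩
  rw [this]
  refine (isCompact_unitVecs.prod isCompact_unitVecs).image ?_
  exact Continuous.matrix_vecMulVec continuous_fst continuous_snd

theorem isClosed_convexHull_unitOps : IsClosed (convexHull ℝ (unitOps m n k)) :=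
  (isCompact_convexHull isCompact_unitOps).isClosed

/-- The defect term expresses strict convexity of the Frobenius ball. -/
theorem frobSq_combo {s t : ℝ} (hst : s + t = 1) (X Y : Op m n) :
    frobSq (s • X + t • Y) = s * frobSq X + t * frobSq Y - s * t * frobSq (X - Y) := by
  have ht : t = 1 - s := by linarith
  subst ht
  simp only [frobSq, Finset.mul_sum, ← Finset.sum_add_distrib, ← Finset.sum_sub_distrib]
  refine Finset.sum_congr rfl fun p _ => Finset.sum_congr rfl fun q _ => ?_
  simp only [Matrix.add_apply, Matrix.smul_apply, Matrix.sub_apply, Complex.sq_norm,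
    Complex.normSq_apply, Complex.add_re, Complex.add_im, Complex.sub_re, Complex.sub_im,
    Complex.real_smul, Complex.re_ofReal_mul, Complex.im_ofReal_mul]
  ring

theorem frobSq_nonneg (X : Op m n) : 0 ≤ frobSq X :=
  Finset.sum_nonneg fun _ _ => Finset.sum_nonneg fun _ _ => sq_nonneg _

theorem eq_zero_of_frobSq {X : Op m n} (h : frobSq X ≤ 0) : X = 0 := by
  have h0 : frobSq X = 0 := le_antisymm h (frobSq_nonneg X)
  ext p q
  have h1 := (Finset.sum_eq_zero_iff_of_nonneg
    fun _ _ => Finset.sum_nonneg fun _ _ => sq_nonneg _).1 h0 p (Finset.mem_univ p)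
  have h2 := (Finset.sum_eq_zero_iff_of_nonneg fun _ _ => sq_nonneg _).1 h1 q (Finset.mem_univ q)
  simpa using h2

theorem frobSq_le_of_mem_convexHull {X : Op m n} (hX : X ∈ convexHull ℝ (unitOps m n k)) :
    frobSq X ≤ 1 := by
  refine convexHull_min (t := {Y : Op m n | frobSq Y ≤ 1})
    (fun Y hY => (frobSq_of_mem_unitOps hY).le) ?_ hX
  intro Y hY Z hZ s t hs ht hst
  have hY : frobSq Y ≤ 1 := hY
  have hZ : frobSq Z ≤ 1 := hZ
  change frobSq (s • Y + t • Z) ≤ 1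
  rw [frobSq_combo hst]
  have h1 := mul_nonneg (mul_nonneg hs ht) (frobSq_nonneg (Y - Z))
  nlinarith

/-- The hull lies in the Frobenius unit ball and the unit operators on its sphere, so by
`frobSq_combo` none of them is interior to a nontrivial segment. -/
theorem extremePoints_convexHull_unitOps :
    (convexHull ℝ (unitOps m n k)).extremePoints ℝ = unitOps m n k := by
  refine Set.Subset.antisymm extremePoints_convexHull_subset fun X hX => ?_
  rw [mem_extremePoints_iff_left]
  refine ⟨subset_convexHull ℝ _ hX, fun Y hY Z hZ hseg => ?_⟩
  obtain ⟨s, t, hs, ht, hst, rfl⟩ := hseg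
  have h1 := frobSq_of_mem_unitOps hX
  rw [frobSq_combo hst] at h1
  have hY1 := frobSq_le_of_mem_convexHull hY
  have hZ1 := frobSq_le_of_mem_convexHull hZ
  have h0 : frobSq (Y - Z) ≤ 0 := by
    have : s * t * frobSq (Y - Z) ≤ 0 := by nlinarith
    by_contra hpos
    push Not at hpos
    exact absurd this (not_le.2 (by positivity))
  have hYZ : Y = Z := sub_eq_zero.1 (eq_zero_of_frobSq h0)
  rw [← hYZ, ← add_smul, hst, one_smul]

/-- A linear bijection of the hull onto itself permutes its extreme points. -/
theorem mem_closure_of_convexHull (hk : 1 ≤ k) (hm : k < m) (hn : k < n)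
    (Φ : Op m n ≃ₗ[ℂ] Op m n)
    (h : ∀ X ∈ convexHull ℝ (unitOps m n k), Φ X ∈ convexHull ℝ (unitOps m n k))
    (h' : ∀ X ∈ convexHull ℝ (unitOps m n k), Φ.symm X ∈ convexHull ℝ (unitOps m n k)) :
    (Φ : Module.End ℂ (Op m n)) ∈ Subsemigroup.closure (generators m n k) := by
  have key : ∀ Ψ : Op m n ≃ₗ[ℂ] Op m n,
      (∀ X ∈ convexHull ℝ (unitOps m n k), Ψ X ∈ convexHull ℝ (unitOps m n k)) →
      (∀ X ∈ convexHull ℝ (unitOps m n k), Ψ.symm X ∈ convexHull ℝ (unitOps m n k)) →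
      ∀ X ∈ unitOps m n k, Ψ X ∈ unitOps m n k := by
    intro Ψ hΨ hΨ' X hX
    have himg : (Ψ.restrictScalars ℝ) '' convexHull ℝ (unitOps m n k) =
        convexHull ℝ (unitOps m n k) := by
      ext Y
      constructor
      · rintro ⟨Z, hZ, rfl⟩; exact hΨ Z hZ
      · exact fun hY => ⟨Ψ.symm Y, hΨ' Y hY, Ψ.apply_symm_apply Y⟩
    have := image_extremePoints (𝕜 := ℝ) (Ψ.restrictScalars ℝ) (convexHull ℝ (unitOps m n k))
    rw [himg, extremePoints_convexHull_unitOps] at this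
    exact this.subset ⟨X, hX, rfl⟩
  exact mem_closure_of_unitOps hk hm hn Φ (key Φ h h') (key Φ.symm h' (by simpa using h))

end ConvexHull

/-! ### The two norms and their duality -/

section Norms

variable {m n k : ℕ}

theorem schmidtRank_le_iff (hm : 0 < m) (hn : 0 < n) (v : Vec m n) :
    schmidtRank v ≤ k ↔ LowRank k v.ofLp := by
  have hset : (coeffMatrix v.ofLp).rank ∈ {r : ℕ | ∃ (c : Fin r → ℂ) (u : Fin r → Vec m n),
      (∀ i, IsSeparable (u i)) ∧ v = ∑ i, c i • u i} := by
    obtain ⟨a, b, hv⟩ := exists_sum_of_rank v.ofLp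
    have hunit : ∀ {r : ℕ}, 0 < r → ∀ x : EuclideanSpace ℂ (Fin r),
        ∃ (t : ℂ) (y : EuclideanSpace ℂ (Fin r)), ‖y‖ = 1 ∧ x = t • y := by
      intro r hr x
      by_cases hx : x = 0
      -- A zero factor is written as zero times a unit vector, which exists because the dimension is
      -- positive.
      · exact ⟨0, EuclideanSpace.single ⟨0, hr⟩ 1, by simp, by simp [hx]⟩
      · have hx0 : (‖x‖ : ℂ) ≠ 0 := by simpa using hx
        refine ⟨‖x‖, (‖x‖ : ℂ)⁻¹ • x, ?_, ?_⟩
        · rw [norm_smul, norm_inv, Complex.norm_real, norm_norm,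
            inv_mul_cancel₀ (norm_ne_zero_iff.2 hx)]
        · rw [smul_smul, mul_inv_cancel₀ hx0, one_smul]
    choose s a' ha' has using fun l => hunit hm (WithLp.toLp 2 (a l))
    choose t b' hb' hbt using fun l => hunit hn (WithLp.toLp 2 (b l))
    refine ⟨fun l => s l * t l, fun l => tensorVec (a' l) (b' l),
      fun l => ⟨a' l, b' l, ha' l, hb' l, rfl⟩, ?_⟩
    ext p
    refine (congrFun hv p).trans ?_
    simp only [WithLp.ofLp_sum, WithLp.ofLp_smul, Finset.sum_apply, Pi.smul_apply, tensorVec,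
      smul_eq_mul]
    refine Finset.sum_congr rfl fun l _ => ?_
    have h1 : a l p.1 = s l * a' l p.1 :=
      congrArg (fun x : EuclideanSpace ℂ (Fin m) => x p.1) (has l)
    have h2 : b l p.2 = t l * b' l p.2 :=
      congrArg (fun x : EuclideanSpace ℂ (Fin n) => x p.2) (hbt l)
    rw [h1, h2]
    ring
  constructor
  · intro h
    obtain ⟨c, u, hu, hv⟩ := Nat.sInf_mem ⟨_, hset⟩
    choose a b ha hb hab using hu
    have : v.ofLp = fun p => ∑ l, (c l • (a l).ofLp) p.1 * (b l).ofLp p.2 := by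
      funext p
      conv_lhs => rw [hv]
      simp only [hab, WithLp.ofLp_sum, WithLp.ofLp_smul, Finset.sum_apply, Pi.smul_apply, tensorVec,
        smul_eq_mul, mul_assoc]
    rw [this]
    refine (lowRank_sum _ _).mono ?_
    rw [Fintype.card_fin]
    exact h
  · exact fun h => (Nat.sInf_le hset).trans h

theorem isPureState_iff (hm : 0 < m) (hn : 0 < n) (v : Vec m n) :
    IsPureState k v ↔ sqNorm v.ofLp = 1 ∧ LowRank k v.ofLp := by
  rw [IsPureState, schmidtRank_le_iff hm hn]
  have : sqNorm v.ofLp = ‖v‖ ^ 2 := (EuclideanSpace.norm_sq_eq v).symm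
  rw [this, pow_eq_one_iff_of_nonneg (norm_nonneg v) two_ne_zero]

open scoped ComplexOrder in
theorem LowRank.star {v : Fin m × Fin n → ℂ} (h : LowRank k v) : LowRank k (star v) := by
  have : coeffMatrix (Star.star v) = (coeffMatrix v)ᴴᵀ := rfl
  rw [LowRank, this, rank_transpose, rank_conjTranspose]
  exact h

theorem sqNorm_star {α : Type*} [Fintype α] (v : α → ℂ) : sqNorm (star v) = sqNorm v := by
  simp [sqNorm]

theorem gammaNorm_eq (hm : 0 < m) (hn : 0 < n) (X : Op m n) :
    gammaNorm k X = sInf {r : ℝ | ∃ (N : ℕ) (c : Fin N → ℂ) (Y : Fin N → Op m n),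
      (∀ i, Y i ∈ unitOps m n k) ∧ X = ∑ i, c i • Y i ∧ r = ∑ i, ‖c i‖} := by
  rw [gammaNorm]
  congr 1
  ext r
  constructor
  · rintro ⟨N, c, v, w, hv, hw, hX, hr⟩
    refine ⟨N, c, _, fun i => ?_, hX, hr⟩
    obtain ⟨h1, h2⟩ := (isPureState_iff hm hn _).1 (hv i)
    obtain ⟨h3, h4⟩ := (isPureState_iff hm hn _).1 (hw i)
    exact ⟨_, _, h1, (sqNorm_star _).trans h3, h2, h4.star, rfl⟩
  · rintro ⟨N, c, Y, hY, hX, hr⟩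
    choose v w hv hw hkv hkw e using hY
    refine ⟨N, c, fun i => WithLp.toLp 2 (v i), fun i => WithLp.toLp 2 (star (w i)),
      fun i => (isPureState_iff hm hn _).2 ⟨hv i, hkv i⟩,
      fun i => (isPureState_iff hm hn _).2 ⟨(sqNorm_star _).trans (hw i), (hkw i).star⟩, ?_, hr⟩
    rw [hX]
    refine Finset.sum_congr rfl fun i _ => ?_
    rw [e i, star_star]

theorem gammaNorm_le {ι : Type*} [Fintype ι] (hm : 0 < m) (hn : 0 < n) {X : Op m n} (c : ι → ℂ)
    (Y : ι → Op m n) (hY : ∀ i, Y i ∈ unitOps m n k) (hX : X = ∑ i, c i • Y i) :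
    gammaNorm k X ≤ ∑ i, ‖c i‖ := by
  rw [gammaNorm_eq hm hn]
  refine csInf_le ⟨0, ?_⟩ ?_
  · rintro r ⟨N, c, Y, -, -, rfl⟩
    exact Finset.sum_nonneg fun _ _ => norm_nonneg _
  · let e := Fintype.equivFin ι
    refine ⟨_, c ∘ e.symm, Y ∘ e.symm, fun i => hY _, ?_, ?_⟩
    · rw [hX]
      exact (e.symm.sum_comp fun i => c i • Y i).symm
    · exact (e.symm.sum_comp fun i => ‖c i‖).symm

/-- The matrix units give at least one decomposition, so the infimum is not the default value of an
empty set. -/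
theorem exists_decomposition (hm : 0 < m) (hn : 0 < n) (hk : 1 ≤ k) (X : Op m n) {r : ℝ}
    (h : gammaNorm k X < r) : ∃ (N : ℕ) (c : Fin N → ℂ) (Y : Fin N → Op m n),
      (∀ i, Y i ∈ unitOps m n k) ∧ X = ∑ i, c i • Y i ∧ ∑ i, ‖c i‖ < r := by
  rw [gammaNorm_eq hm hn] at h
  have hne : {r : ℝ | ∃ (N : ℕ) (c : Fin N → ℂ) (Y : Fin N → Op m n),
      (∀ i, Y i ∈ unitOps m n k) ∧ X = ∑ i, c i • Y i ∧ r = ∑ i, ‖c i‖}.Nonempty := by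
    let e := Fintype.equivFin ((Fin m × Fin n) × (Fin m × Fin n))
    refine ⟨_, _, fun i => X (e.symm i).1 (e.symm i).2, fun i =>
      Matrix.single (e.symm i).1 (e.symm i).2 1, fun i => single_mem_unitOps hk _ _, ?_, rfl⟩
    have := e.symm.sum_comp fun q => X q.1 q.2 • Matrix.single q.1 q.2 (1 : ℂ)
    rw [this, Fintype.sum_prod_type]
    conv_lhs => rw [matrix_eq_sum_single X]
    simp [Matrix.smul_single]
  obtain ⟨_, ⟨N, c, Y, hY, hX, rfl⟩, hlt⟩ := exists_lt_of_csInf_lt hne h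
  exact ⟨N, c, Y, hY, hX, hlt⟩

theorem norm_apply_le_of_mem_unitOps {Y : Op m n} (hY : Y ∈ unitOps m n k)
    (p q : Fin m × Fin n) : ‖Y p q‖ ≤ 1 := by
  have h1 := frobSq_of_mem_unitOps hY
  have h2 : ‖Y p q‖ ^ 2 ≤ frobSq Y :=
    (Finset.single_le_sum (f := fun q => ‖Y p q‖ ^ 2) (fun _ _ => sq_nonneg _)
      (Finset.mem_univ q)).trans (Finset.single_le_sum (f := fun p => ∑ q, ‖Y p q‖ ^ 2)
        (fun _ _ => Finset.sum_nonneg fun _ _ => sq_nonneg _) (Finset.mem_univ p))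
  have := norm_nonneg (Y p q)
  nlinarith

theorem eq_zero_of_gammaNorm (hm : 0 < m) (hn : 0 < n) (hk : 1 ≤ k) {X : Op m n}
    (h : gammaNorm k X = 0) : X = 0 := by
  ext p q
  refine norm_le_zero_iff.1 (le_of_forall_pos_lt_add fun ε hε => ?_)
  obtain ⟨N, c, Y, hY, rfl, hc⟩ := exists_decomposition hm hn hk X (r := ε) (by rwa [h])
  rw [zero_add]
  refine lt_of_le_of_lt ?_ hc
  rw [Matrix.sum_apply]
  refine (norm_sum_le _ _).trans (Finset.sum_le_sum fun i _ => ?_)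
  rw [Matrix.smul_apply, norm_smul]
  exact mul_le_of_le_one_right (norm_nonneg _) (norm_apply_le_of_mem_unitOps (hY i) p q)

theorem zero_mem_convexHull_unitOps (hm : 0 < m) (hn : 0 < n) (hk : 1 ≤ k) :
    (0 : Op m n) ∈ convexHull ℝ (unitOps m n k) := by
  let p : Fin m × Fin n := (⟨0, hm⟩, ⟨0, hn⟩)
  have h1 := single_mem_unitOps hk p p
  have h2 := smul_mem_unitOps h1 (c := -1) (by simp)
  have := (convex_convexHull ℝ (unitOps m n k)) (subset_convexHull ℝ _ h1)
    (subset_convexHull ℝ _ h2) (a := 1 / 2) (b := 1 / 2) (by norm_num) (by norm_num) (by norm_num)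
  have e : ((1 / 2 : ℝ) • Matrix.single p p (1 : ℂ) +
      (1 / 2 : ℝ) • (-1 : ℂ) • Matrix.single p p (1 : ℂ) : Op m n) = 0 := by
    rw [neg_one_smul, smul_neg, add_neg_cancel]
  rwa [e] at this

/-- The unit ball of `‖·‖_{γ,k}` is the convex hull of the operators `v w^T`. -/
theorem gammaNorm_le_one_iff (hm : 0 < m) (hn : 0 < n) (hk : 1 ≤ k) (X : Op m n) :
    gammaNorm k X ≤ 1 ↔ X ∈ convexHull ℝ (unitOps m n k) := by
  constructor
  · intro h
    -- The infimum is not known to be attained, so `X` is shrunk slightly and recovered as `r → 1`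
    -- by closedness. Phases of the coefficients are absorbed into the unit operators.
    have hmem : ∀ r : ℝ, 1 < r → r⁻¹ • X ∈ convexHull ℝ (unitOps m n k) := by
      intro r hr
      obtain ⟨N, c, Y, hY, hX, hc⟩ := exists_decomposition hm hn hk X (h.trans_lt hr)
      have hs : 0 ≤ ∑ i, ‖c i‖ := Finset.sum_nonneg fun _ _ => norm_nonneg _
      rcases hs.eq_or_lt with h0 | hpos
      · have : X = 0 := by
          rw [hX]
          refine Finset.sum_eq_zero fun i _ => ?_
          have := (Finset.sum_eq_zero_iff_of_nonneg fun _ _ => norm_nonneg _).1 h0.symm i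
            (Finset.mem_univ i)
          rw [norm_eq_zero.1 this, zero_smul]
        rw [this, smul_zero]
        exact zero_mem_convexHull_unitOps hm hn hk
      · set s := ∑ i, ‖c i‖ with hsdef
        have hphase : ∀ z : ℂ, ∃ u : ℂ, ‖u‖ = 1 ∧ z = ‖z‖ * u := by
          intro z
          by_cases hz : z = 0
          · exact ⟨1, by simp, by simp [hz]⟩
          · have hz' : (‖z‖ : ℂ) ≠ 0 := by simpa using hz
            exact ⟨z / ‖z‖, by simp [hz], by field_simp⟩
        choose u hu hcu using fun i => hphase (c i)
        have h1 : s⁻¹ • X ∈ convexHull ℝ (unitOps m n k) := by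
          refine mem_convexHull_of_exists_fintype (fun i => s⁻¹ * ‖c i‖) (fun i => u i • Y i)
            (fun i => by positivity) ?_ (fun i => smul_mem_unitOps (hY i) (hu i)) ?_
          · rw [← Finset.mul_sum, inv_mul_cancel₀ hpos.ne']
          · rw [hX, Finset.smul_sum]
            refine Finset.sum_congr rfl fun i _ => ?_
            conv_rhs => rw [hcu i]
            rw [mul_smul, mul_smul]
            rfl
        have h2 := (convex_convexHull ℝ (unitOps m n k)).smul_mem_of_zero_mem
          (zero_mem_convexHull_unitOps hm hn hk) h1 (t := r⁻¹ * s)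
          ⟨by positivity, by
            rw [inv_mul_le_iff₀ (by linarith)]; linarith⟩
        rwa [smul_smul, mul_assoc, mul_inv_cancel₀ hpos.ne', mul_one] at h2
    have hlim : Filter.Tendsto (fun r : ℝ => r⁻¹ • X) (nhdsWithin 1 (Set.Ioi 1)) (nhds X) := by
      have : Filter.Tendsto (fun r : ℝ => r⁻¹ • X) (nhds 1) (nhds ((1 : ℝ)⁻¹ • X)) :=
        (tendsto_inv₀ one_ne_zero).smul_const X
      rw [inv_one, one_smul] at this
      exact this.mono_left nhdsWithin_le_nhds
    refine isClosed_convexHull_unitOps.mem_of_tendsto hlim ?_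
    filter_upwards [self_mem_nhdsWithin] with r hr using hmem r hr
  · intro h
    obtain ⟨ι, _, w, z, hw, hw1, hz, hX⟩ := mem_convexHull_iff_exists_fintype.1 h
    have := gammaNorm_le hm hn (fun i => (w i : ℂ)) z hz (X := X) (by rw [← hX]; rfl)
    refine this.trans (le_of_eq ?_)
    rw [← hw1]
    exact Finset.sum_congr rfl fun i _ => by simp [abs_of_nonneg (hw i)]

theorem pairing_comm (X Y : Op m n) : pairing X Y = pairing Y X := by
  simp only [pairing_eq_sum, mul_comm]

theorem pairing_single (X : Op m n) (p q : Fin m × Fin n) :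
    pairing X (Matrix.single p q 1) = X p q := by
  rw [pairing_eq_sum, Finset.sum_eq_single p, Finset.sum_eq_single q]
  · simp
  · intro r _ hr; simp [hr.symm]
  · simp
  · intro r _ hr; simp [hr.symm]
  · simp

theorem skNorm_eq (hm : 0 < m) (hn : 0 < n) (X : Op m n) :
    skNorm k X = sSup ((fun Y => ‖pairing Y X‖) '' unitOps m n k) := by
  have hpair : ∀ v w : Fin m × Fin n → ℂ,
      pairing (vecMulVec (star v) w) X = star v ⬝ᵥ (X *ᵥ w) := by
    intro v w
    simp only [pairing_eq_sum, vecMulVec_apply, dotProduct, mulVec, Finset.mul_sum]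
    exact Finset.sum_congr rfl fun _ _ => Finset.sum_congr rfl fun _ _ => by ring
  rw [skNorm]
  congr 1
  ext r
  constructor
  · rintro ⟨v, w, hv, hw, rfl⟩
    obtain ⟨h1, h2⟩ := (isPureState_iff hm hn _).1 hv
    obtain ⟨h3, h4⟩ := (isPureState_iff hm hn _).1 hw
    exact ⟨_, ⟨_, _, (sqNorm_star _).trans h1, h3, h2.star, h4, rfl⟩, congrArg _ (hpair _ _)⟩
  · rintro ⟨_, ⟨v, w, hv, hw, hkv, hkw, rfl⟩, rfl⟩
    refine ⟨WithLp.toLp 2 (star v), WithLp.toLp 2 w,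
      (isPureState_iff hm hn _).2 ⟨(sqNorm_star _).trans hv, hkv.star⟩,
      (isPureState_iff hm hn _).2 ⟨hw, hkw⟩, ?_⟩
    rw [← hpair, star_star]

theorem norm_pairing_le_skNorm (hm : 0 < m) (hn : 0 < n) {Y : Op m n} (hY : Y ∈ unitOps m n k)
    (X : Op m n) : ‖pairing Y X‖ ≤ skNorm k X := by
  rw [skNorm_eq hm hn]
  refine le_csSup ⟨∑ p, ∑ q, ‖X p q‖, ?_⟩ ⟨Y, hY, rfl⟩
  rintro _ ⟨Z, hZ, rfl⟩
  simp only [pairing_eq_sum]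
  refine (norm_sum_le _ _).trans (Finset.sum_le_sum fun p _ => (norm_sum_le _ _).trans
    (Finset.sum_le_sum fun q _ => ?_))
  rw [norm_mul]
  exact mul_le_of_le_one_left (norm_nonneg _) (norm_apply_le_of_mem_unitOps hZ p q)

theorem skNorm_le (hm : 0 < m) (hn : 0 < n) (hk : 1 ≤ k) {X : Op m n} {r : ℝ}
    (h : ∀ Y ∈ unitOps m n k, ‖pairing Y X‖ ≤ r) : skNorm k X ≤ r := by
  rw [skNorm_eq hm hn]
  refine csSup_le ?_ ?_
  · exact ⟨_, _, single_mem_unitOps hk (⟨0, hm⟩, ⟨0, hn⟩) (⟨0, hm⟩, ⟨0, hn⟩), rfl⟩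
  · rintro _ ⟨Y, hY, rfl⟩
    exact h Y hY

theorem eq_zero_of_skNorm (hm : 0 < m) (hn : 0 < n) (hk : 1 ≤ k) {X : Op m n}
    (h : skNorm k X = 0) : X = 0 := by
  ext p q
  have := norm_pairing_le_skNorm hm hn (single_mem_unitOps hk p q) X
  rw [h, pairing_comm, pairing_single] at this
  exact norm_le_zero_iff.1 this

theorem re_pairing_le_skNorm (hm : 0 < m) (hn : 0 < n) {Y : Op m n}
    (hY : Y ∈ convexHull ℝ (unitOps m n k)) (X : Op m n) : (pairing Y X).re ≤ skNorm k X := by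
  refine convexHull_min (t := {Z : Op m n | (pairing Z X).re ≤ skNorm k X})
    (fun Z hZ => (Complex.re_le_norm _).trans (norm_pairing_le_skNorm hm hn hZ X)) ?_ hY
  refine convex_halfSpace_le (f := fun Z : Op m n => (pairing Z X).re)
    ⟨fun A B => ?_, fun r A => ?_⟩ _
  · simp [pairing, Matrix.add_mul]
  · simp [pairing]

/-- The transpose of a linear map with respect to the bilinear pairing. -/
def pairingTranspose (Φ : Module.End ℂ (Op m n)) : Module.End ℂ (Op m n) where
  toFun Y := Matrix.of fun p q => pairing Y (Φ (Matrix.single p q 1))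
  map_add' Y Z := by ext p q; simp [pairing, Matrix.add_mul]
  map_smul' c Y := by ext p q; simp [pairing]

theorem apply_eq_pairing {f : Op m n →ₗ[ℂ] ℂ} (X : Op m n) :
    f X = pairing (Matrix.of fun p q => f (Matrix.single p q 1)) X := by
  conv_lhs => rw [matrix_eq_sum_single X]
  rw [pairing_eq_sum, map_sum]
  refine Finset.sum_congr rfl fun p _ => ?_
  rw [map_sum]
  refine Finset.sum_congr rfl fun q _ => ?_
  have : Matrix.single p q (X p q) = X p q • Matrix.single p q (1 : ℂ) := by
    simp [Matrix.smul_single]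
  rw [this, map_smul, of_apply, smul_eq_mul, mul_comm]

theorem pairing_pairingTranspose (Φ : Module.End ℂ (Op m n)) (Y X : Op m n) :
    pairing (pairingTranspose Φ Y) X = pairing Y (Φ X) := by
  let f : Op m n →ₗ[ℂ] ℂ :=
    { toFun := fun X => pairing Y (Φ X)
      map_add' := fun A B => by simp [pairing, Matrix.mul_add]
      map_smul' := fun c A => by simp [pairing] }
  exact (apply_eq_pairing (f := f) X).symm

theorem eq_of_pairing {X Y : Op m n} (h : ∀ Z, pairing X Z = pairing Y Z) : X = Y := by
  ext p q
  rw [← pairing_single X, ← pairing_single Y, h]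

/-- If `Φ` does not increase the `S(k)`-norm, then its transpose preserves the convex hull of the
operators `v w^T`. -/
theorem pairingTranspose_mem_convexHull (hm : 0 < m) (hn : 0 < n) (hk : 1 ≤ k)
    {Φ : Module.End ℂ (Op m n)} (h : ∀ X, skNorm k (Φ X) ≤ skNorm k X) {Y : Op m n}
    (hY : Y ∈ convexHull ℝ (unitOps m n k)) :
    pairingTranspose Φ Y ∈ convexHull ℝ (unitOps m n k) := by
  by_contra hno
  have : LocallyConvexSpace ℝ (Op m n) :=
    inferInstanceAs (LocallyConvexSpace ℝ (Fin m × Fin n → Fin m × Fin n → ℂ))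
  -- The separating functional is pairing with some `Z`. K is invariant under phases, so the bound
  -- on real parts bounds moduli and gives `skNorm k Z ≤ u`, while `u` is less than the real part of
  -- the pairing of `Y` with `Φ Z`.
  obtain ⟨f, u, hf, hu⟩ := RCLike.geometric_hahn_banach_closed_point (𝕜 := ℂ)
    (convex_convexHull ℝ (unitOps m n k)) isClosed_convexHull_unitOps hno
  let Z : Op m n := Matrix.of fun p q => f (Matrix.single p q 1)
  have hfZ : ∀ X, f X = pairing X Z := fun X =>
    (apply_eq_pairing (f := (f : Op m n →ₗ[ℂ] ℂ)) X).trans (pairing_comm _ _)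
  have hle : skNorm k Z ≤ u := by
    refine skNorm_le hm hn hk fun X hX => ?_
    by_cases h0 : pairing X Z = 0
    · have := hf X (subset_convexHull ℝ _ hX)
      rw [hfZ, h0] at this
      rw [h0, norm_zero]
      exact (by simpa using this : (0 : ℝ) < u).le
    · have hn0 : (‖pairing X Z‖ : ℂ) ≠ 0 := by simpa using h0
      have hc : ‖(‖pairing X Z‖ : ℂ) / pairing X Z‖ = 1 := by simp [h0]
      have := hf _ (subset_convexHull ℝ _ (smul_mem_unitOps hX hc))
      rw [hfZ] at this
      have e : pairing (((‖pairing X Z‖ : ℂ) / pairing X Z) • X) Z = (‖pairing X Z‖ : ℂ) := by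
        rw [pairing, transpose_smul, Matrix.smul_mul, trace_smul, ← pairing, smul_eq_mul,
          div_mul_cancel₀ _ h0]
      rw [e] at this
      exact (by simpa using this : ‖pairing X Z‖ < u).le
  rw [hfZ, pairing_pairingTranspose] at hu
  have h1 := re_pairing_le_skNorm hm hn hY (Φ Z)
  have h2 : u < (pairing Y (Φ Z)).re := hu
  linarith [h Z]

/-- The transpose of `Φ` is again a composition of generators, hence maps the unit operators
defining the supremum to unit operators. -/
theorem skNorm_map_le (hm : 0 < m) (hn : 0 < n) (hk : 1 ≤ k) {Φ : Module.End ℂ (Op m n)}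
    (hΦ : Φ ∈ Subsemigroup.closure (generators m n k)) (X : Op m n) :
    skNorm k (Φ X) ≤ skNorm k X := by
  obtain ⟨Ψ, hΨ, h⟩ := closure_exists_transpose hΦ
  refine skNorm_le hm hn hk fun Y hY => ?_
  rw [pairing_comm, h, pairing_comm]
  exact norm_pairing_le_skNorm hm hn (closure_mem_unitOps hΨ Y hY) X

theorem gammaNorm_map_le (hm : 0 < m) (hn : 0 < n) (hk : 1 ≤ k) {Φ : Module.End ℂ (Op m n)}
    (hΦ : Φ ∈ Subsemigroup.closure (generators m n k)) (X : Op m n) :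
    gammaNorm k (Φ X) ≤ gammaNorm k X := by
  refine le_of_forall_gt fun r hr => ?_
  obtain ⟨N, c, Y, hY, hX, hc⟩ := exists_decomposition hm hn hk X hr
  refine lt_of_le_of_lt (gammaNorm_le hm hn c (fun i => Φ (Y i))
    (fun i => closure_mem_unitOps hΦ _ (hY i)) ?_) hc
  rw [hX, map_sum]
  simp only [map_smul]

theorem mem_closure_of_gammaNorm (hk : 1 ≤ k) (hm : k < m) (hn : k < n)
    {Φ : Module.End ℂ (Op m n)} (h : ∀ X, gammaNorm k (Φ X) = gammaNorm k X) :
    Φ ∈ Subsemigroup.closure (generators m n k) := by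
  have hm0 : 0 < m := by omega
  have hn0 : 0 < n := by omega
  have hzero : gammaNorm k (0 : Op m n) = 0 := by
    refine le_antisymm ?_ ?_
    · simpa using gammaNorm_le (k := k) hm0 hn0 (X := 0) (fun i : Fin 0 => (0 : ℂ)) (fun _ => 0)
        (fun i => i.elim0) (by simp)
    · rw [gammaNorm_eq hm0 hn0]
      refine Real.sInf_nonneg ?_
      rintro r ⟨N, c, Y, -, -, rfl⟩
      exact Finset.sum_nonneg fun _ _ => norm_nonneg _
  have hinj : Function.Injective Φ := (injective_iff_map_eq_zero Φ).2 fun X hX =>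
    eq_zero_of_gammaNorm hm0 hn0 hk (by rw [← h, hX, hzero])
  let e := LinearEquiv.ofInjectiveEndo Φ hinj
  refine mem_closure_of_convexHull hk hm hn e (fun X hX => ?_) fun X hX => ?_
  · rw [← gammaNorm_le_one_iff hm0 hn0 hk] at *
    exact (h X).le.trans hX
  · rw [← gammaNorm_le_one_iff hm0 hn0 hk] at *
    rw [← h]
    have : Φ (e.symm X) = X := e.apply_symm_apply X
    rwa [this]

/-- The transpose of `Φ` and that of its inverse preserve the hull, so the transpose is a
composition of generators; transposing once more recovers `Φ`. -/
theorem mem_closure_of_skNorm (hk : 1 ≤ k) (hm : k < m) (hn : k < n)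
    {Φ : Module.End ℂ (Op m n)} (h : ∀ X, skNorm k (Φ X) = skNorm k X) :
    Φ ∈ Subsemigroup.closure (generators m n k) := by
  have hm0 : 0 < m := by omega
  have hn0 : 0 < n := by omega
  have hzero : skNorm k (0 : Op m n) = 0 := by
    refine le_antisymm (skNorm_le hm0 hn0 hk fun Y _ => by simp [pairing]) ?_
    exact (norm_nonneg _).trans (norm_pairing_le_skNorm hm0 hn0
      (single_mem_unitOps hk (⟨0, hm0⟩, ⟨0, hn0⟩) (⟨0, hm0⟩, ⟨0, hn0⟩)) 0)
  have hinj : Function.Injective Φ := (injective_iff_map_eq_zero Φ).2 fun X hX =>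
    eq_zero_of_skNorm hm0 hn0 hk (by rw [← h, hX, hzero])
  let e := LinearEquiv.ofInjectiveEndo Φ hinj
  have hes : ∀ X, Φ (e.symm X) = X := fun X => e.apply_symm_apply X
  have hse : ∀ X, e.symm (Φ X) = X := fun X => e.symm_apply_apply X
  let T : Op m n ≃ₗ[ℂ] Op m n := LinearEquiv.ofLinearMap (pairingTranspose Φ)
    (pairingTranspose (e.symm : Module.End ℂ (Op m n)))
    (LinearMap.ext fun Y => eq_of_pairing fun Z => by
      rw [LinearMap.comp_apply, pairing_pairingTranspose, pairing_pairingTranspose]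
      exact congrArg _ (hse Z))
    (LinearMap.ext fun Y => eq_of_pairing fun Z => by
      rw [LinearMap.comp_apply, pairing_pairingTranspose, pairing_pairingTranspose]
      exact congrArg _ (hes Z))
  have hT := mem_closure_of_convexHull hk hm hn T
    (fun Y hY => pairingTranspose_mem_convexHull hm0 hn0 hk (fun X => (h X).le) hY)
    (fun Y hY => pairingTranspose_mem_convexHull hm0 hn0 hk (fun X => by
      rw [LinearEquiv.coe_coe, ← h, hes]) hY)
  obtain ⟨Ψ, hΨ, hTΨ⟩ := closure_exists_transpose hT
  have : Φ = Ψ := LinearMap.ext fun X => eq_of_pairing fun Z => by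
    rw [pairing_comm, ← pairing_pairingTranspose, pairing_comm (Ψ X), ← hTΨ]
    rfl
  rwa [this]

end Norms

end EntNorm

end

theorem theorem6p1 (m n k : ℕ) (hk : 1 ≤ k) (hkmn : k < min m n)
    (Φ : EntNorm.Op m n →ₗ[ℂ] EntNorm.Op m n) :
    List.TFAE [
      ∀ X : EntNorm.Op m n, EntNorm.skNorm k (Φ X) = EntNorm.skNorm k X,
      ∀ X : EntNorm.Op m n, EntNorm.gammaNorm k (Φ X) = EntNorm.gammaNorm k X,
      Φ ∈ Subsemigroup.closure (EntNorm.generators m n k)] := by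
  obtain ⟨hm, hn⟩ := lt_min_iff.1 hkmn
  have hm0 : 0 < m := by omega
  have hn0 : 0 < n := by omega
  tfae_have 1 → 3 := EntNorm.mem_closure_of_skNorm hk hm hn
  tfae_have 2 → 3 := EntNorm.mem_closure_of_gammaNorm hk hm hn
  tfae_have 3 → 1 := by
    intro h X
    -- Compositions of generators are contractions; applying this to the inverse gives the opposite
    -- inequality.
    obtain ⟨Ψ, hΨ, -, hinv⟩ := EntNorm.closure_exists_inverse h
    refine le_antisymm (EntNorm.skNorm_map_le hm0 hn0 hk h X) ?_
    have := EntNorm.skNorm_map_le hm0 hn0 hk hΨ (Φ X)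
    rwa [← Module.End.mul_apply, hinv, Module.End.one_apply] at this
  tfae_have 3 → 2 := by
    intro h X
    obtain ⟨Ψ, hΨ, -, hinv⟩ := EntNorm.closure_exists_inverse h
    refine le_antisymm (EntNorm.gammaNorm_map_le hm0 hn0 hk h X) ?_
    have := EntNorm.gammaNorm_map_le hm0 hn0 hk hΨ (Φ X)
    rwa [← Module.End.mul_apply, hinv, Module.End.one_apply] at this
  tfae_finish
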